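/- A (directed) graph $\Gamma$ consists of a set $\Gamma^0$ of vertices, a set $\Gamma^1$ of edges (of arbitrary cardinality) and maps $s,r:\Gamma^1\to\Gamma^0$ (source and range). Let $F$ be a field. The Leavitt path algebra $L_F(\Gamma)$ is the (not necessarily unital) associative $F$-algebra generated by $\Gamma^0\cup\Gamma^1\cup(\Gamma^1)^*$, where $(\Gamma^1)^*=\{e^*:e\in\Gamma^1\}$, $s(e^*)=r(e)$, $r(e^*)=s(e)$ and $s(v)=r(v)=v$ for $v\in\Gamma^0$, subject to the relations: $s(x)x=x\,r(x)=x$ for every generator $x$; $uv=0$ for distinct vertices $u,v$; $e^*f=0$ for distinct edges $e,f$; $e^*e=r(e)$ for every edge $e$; and $v=\sum_{s(e)=v}ee^*$ for every vertex $v$ that is the source of at least one and of only finitely many edges. The Leavitt inverse semigroup $LI(\Gamma)$ is the multiplicative subsemigroup (with zero) of $L_F(\Gamma)$ generated by $0$ and $\Gamma^0\cup\Gamma^1\cup(\Gamma^1)^*$. An edge $e$ is an NE edge if $s(e)$ has out-degree $1$; an NE path is a (possibly empty) directed path all of whose edges are NE. For $v_1,v_2\in\Gamma^0$ write $v_1\sim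 v_2$ if there are NE paths starting at $v_1$ and at $v_2$ and ending at the same vertex; this is an equivalence relation, and $[v]$ denotes the class of $v$. Let $\Gamma_{[v]}$ be the subgraph of $\Gamma$ induced by the vertex set $[v]$. A set of NE spanning trees of $\Gamma$ is a family $\{T_{[v]}\}$, indexed by the $\sim$-classes, where $T_{[v]}$ is a spanning tree of $\Gamma_{[v]}$ all of whose edges are NE edges of $\Gamma$. (A tree is a graph in which any two vertices are joined by an undirected path and which has no nontrivial reduced undirected circuit.) Given such a set, the contracted graph $\bar\Gamma$ has vertex set $\{[v]:v\in\Gamma^0\}$ and one edge $\bar e$ for every edge $e\in\Gamma^1$ lying in none of the trees, with $s(\bar e)=[s(e)]$ and $r(\bar e)=[r(e)]$; the contraction map on vertices is $\chi_\Gamma(v)=[v]$. Theorem. Let $\Gamma$ and $\Delta$ be graphs. Then $LI(\Gamma)\cong LI(\Delta)$ (as semigroups) if and only if there are a bijection $\psi:\Gamma^0\to\Delta^0$, sets of NE spanning trees $\{T_{[v]}:v\in\Gamma^0\}$ of $\Gamma$ and $\{T'_{[u]}:u\in\Delta^0\}$ of $\Delta$, and an isomorphism of directed graphs $\bar\phi:\bar\Gamma\to\bar\Delta$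 between the corresponding contracted graphs such that $\bar\phi(\chi_\Gamma(v))=\chi_\Delta(\psi(v))$ for all $v\in\Gamma^0$. -/

import Mathlib

/-- A directed graph (loops and multiple edges allowed): a type of vertices, a type of edges,
a source mapping and a range mapping. -/
structure DirGraph.{u, v} where
  /-- the vertices -/
  V : Type u
  /-- the edges -/
  E : Type v
  /-- the source of an edge -/
  src : E → V
  /-- the range of an edge -/
  rng : E → V

namespace DirGraph

/-! ### Paths -/

/-- `Γ.IsPath v p w`: the list of edges `p` is a (possibly empty) directed path from `v` to `w`. -/
inductive IsPath (Γ : DirGraph) : Γ.V → List Γ.E → Γ.V → Prop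
  | nil (v : Γ.V) : IsPath Γ v [] v
  | cons (e : Γ.E) {p : List Γ.E} {w : Γ.V} (h : IsPath Γ (Γ.rng e) p w) :
      IsPath Γ (Γ.src e) (e :: p) w

/-- The out-degree of a vertex. -/
noncomputable def outDegree (Γ : DirGraph) (v : Γ.V) : ℕ∞ :=
  {e : Γ.E | Γ.src e = v}.encard

/-- An edge without exits: its source has out-degree one. -/
def IsNE (Γ : DirGraph) (e : Γ.E) : Prop := Γ.outDegree (Γ.src e) = 1

/-- A directed path without exits (NE path); empty paths are NE paths. -/
def IsNEPath (Γ : DirGraph) (v : Γ.V) (p : List Γ.E) (w : Γ.V) : Prop :=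
  Γ.IsPath v p w ∧ ∀ e ∈ p, Γ.IsNE e

/-- The relation `∼` on vertices: there are NE paths from `v₁` and from `v₂` with the same
range. -/
def NERel (Γ : DirGraph) (v₁ v₂ : Γ.V) : Prop :=
  ∃ (p q : List Γ.E) (w : Γ.V), Γ.IsNEPath v₁ p w ∧ Γ.IsNEPath v₂ q w

theorem IsPath.append {Γ : DirGraph} {u v w : Γ.V} {p q : List Γ.E}
    (hp : Γ.IsPath u p v) (hq : Γ.IsPath v q w) : Γ.IsPath u (p ++ q) w := by
  induction hp with
  | nil v => exact hq
  | cons e _ ih => exact IsPath.cons e (ih hq)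

theorem IsNEPath.append {Γ : DirGraph} {u v w : Γ.V} {p q : List Γ.E}
    (hp : Γ.IsNEPath u p v) (hq : Γ.IsNEPath v q w) : Γ.IsNEPath u (p ++ q) w := by
  refine ⟨hp.1.append hq.1, fun e he => ?_⟩
  rcases List.mem_append.1 he with h | h
  · exact hp.2 e h
  · exact hq.2 e h

/-- Of two NE paths with the same source, one is an initial segment of the other. -/
theorem IsNEPath.comparable {Γ : DirGraph} {v w w' : Γ.V} {p q : List Γ.E}
    (hp : Γ.IsNEPath v p w) (hq : Γ.IsNEPath v q w') :
    ∃ t, Γ.IsNEPath w t w' ∨ Γ.IsNEPath w' t w := by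
  obtain ⟨hp, hpe⟩ := hp
  induction hp generalizing q with
  | nil v => exact ⟨q, Or.inl hq⟩
  | @cons e p w hp ih =>
    obtain ⟨hq, hqe⟩ := hq
    generalize hv : Γ.src e = v at hq
    cases hq with
    | nil => exact ⟨e :: p, Or.inr ⟨hv ▸ IsPath.cons e hp, hpe⟩⟩
    | @cons f q _ hq' =>
      have hfe : f = e := by
        have h1 : Γ.IsNE e := hpe e (by simp)
        obtain ⟨x, hx⟩ := Set.encard_eq_one.1 h1
        have he' : e ∈ ({x} : Set Γ.E) := hx ▸ (rfl : Γ.src e = Γ.src e)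
        have hf' : f ∈ ({x} : Set Γ.E) := hx ▸ (hv.symm : Γ.src f = Γ.src e)
        exact (Set.mem_singleton_iff.1 hf').trans (Set.mem_singleton_iff.1 he').symm
      subst hfe
      exact ih ⟨hq', fun e' he' => hqe e' (List.mem_cons_of_mem _ he')⟩
        (fun e' he' => hpe e' (List.mem_cons_of_mem _ he'))

theorem neRel_equivalence (Γ : DirGraph) : Equivalence Γ.NERel where
  refl v := ⟨[], [], v, ⟨IsPath.nil v, by simp⟩, ⟨IsPath.nil v, by simp⟩⟩
  symm := fun ⟨p, q, w, hp, hq⟩ => ⟨q, p, w, hq, hp⟩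
  trans := by
    rintro x y z ⟨p₁, q₁, w₁, hp₁, hq₁⟩ ⟨p₂, q₂, w₂, hp₂, hq₂⟩
    obtain ⟨t, ht | ht⟩ := hq₁.comparable hp₂
    · exact ⟨p₁ ++ t, q₂, w₂, hp₁.append ht, hq₂⟩
    · exact ⟨p₁, q₂ ++ t, w₁, hp₁, hq₂.append ht⟩

/-- The equivalence relation `∼` on the vertices. -/
def neSetoid (Γ : DirGraph) : Setoid Γ.V := ⟨Γ.NERel, Γ.neRel_equivalence⟩

/-- The set of `∼`-classes of vertices. -/
def NEClass (Γ : DirGraph) : Type _ := Quotient Γ.neSetoid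

/-- The `∼`-class `[v]` of a vertex `v`. -/
def cls (Γ : DirGraph) (v : Γ.V) : Γ.NEClass := Quotient.mk Γ.neSetoid v

/-! ### Trees and NE spanning trees -/

/-- The graph obtained by adjoining to every edge `e` an inverse edge `e*`: `Sum.inl e` stands
for `e`, `Sum.inr e` for `e*`, and `Sum.swap` is the involution `*`. A directed path of
`Γ.double` is a path of `Γ` in which edges may be read in either direction. -/
def double (Γ : DirGraph) : DirGraph where
  V := Γ.V
  E := Γ.E ⊕ Γ.E
  src := Sum.elim Γ.src Γ.rng
  rng := Sum.elim Γ.rng Γ.src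

/-- Any two vertices are joined by an undirected path. -/
def IsConnected (Γ : DirGraph) : Prop :=
  ∀ v w : Γ.V, ∃ p : List (Γ.E ⊕ Γ.E), Γ.double.IsPath v p w

/-- A reduced circuit at `v`: an undirected path `e₁ ⋯ eₙ` from `v` to `v` such that
`eᵢ ≠ eᵢ₊₁*` for all `i < n`, and `e₁ ≠ eₙ*`. -/
def IsReducedCircuit (Γ : DirGraph) (v : Γ.V) (p : List (Γ.E ⊕ Γ.E)) : Prop :=
  Γ.double.IsPath v p v ∧ p.IsChain (fun a b => a ≠ b.swap) ∧
    ∀ a ∈ p.head?, ∀ b ∈ p.getLast?, a ≠ b.swap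

/-- A tree: a connected graph without nontrivial reduced circuits. -/
def IsTree (Γ : DirGraph) : Prop :=
  Γ.IsConnected ∧ ∀ (v : Γ.V) (p : List (Γ.E ⊕ Γ.E)), Γ.IsReducedCircuit v p → p = []

/-- The subgraph with vertex set `S` and edge set `T`, for a set `T` of edges with both ends
in `S`. -/
def subgraph (Γ : DirGraph) (S : Set Γ.V) (T : Set Γ.E)
    (h : ∀ e ∈ T, Γ.src e ∈ S ∧ Γ.rng e ∈ S) : DirGraph where
  V := S
  E := T
  src := fun e => ⟨Γ.src e, (h e e.2).1⟩
  rng := fun e => ⟨Γ.rng e, (h e e.2).2⟩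

/-- A set of NE spanning trees of `Γ`: for every `∼`-class `c`, a spanning tree of the subgraph
of `Γ` induced by `c`, given by its set of edges, all of which are NE edges of `Γ`. -/
structure NESpanningTrees (Γ : DirGraph) where
  /-- the edges of the spanning tree of the class `c` -/
  edges : Γ.NEClass → Set Γ.E
  /-- both ends of these edges lie in the class `c` -/
  ends_mem : ∀ c, ∀ e ∈ edges c, Γ.src e ∈ {v | Γ.cls v = c} ∧ Γ.rng e ∈ {v | Γ.cls v = c}
  /-- these edges, with all vertices of the class `c`, form a tree -/
  isTree : ∀ c, (Γ.subgraph {v | Γ.cls v = c} (edges c) (ends_mem c)).IsTree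
  /-- all these edges are NE edges of `Γ` -/
  isNE : ∀ c, ∀ e ∈ edges c, Γ.IsNE e

/-- The contracted graph: its vertices are the `∼`-classes, its edges are the edges of `Γ` that
lie in none of the chosen spanning trees. -/
def contract (Γ : DirGraph) (T : Γ.NESpanningTrees) : DirGraph where
  V := Γ.NEClass
  E := {e : Γ.E // ∀ c, e ∉ T.edges c}
  src := fun e => Γ.cls (Γ.src e)
  rng := fun e => Γ.cls (Γ.rng e)

/-- The contraction map on vertices, `v ↦ [v]`. -/
def contractV (Γ : DirGraph) (T : Γ.NESpanningTrees) (v : Γ.V) : (Γ.contract T).V := Γ.cls v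

/-- An isomorphism of directed graphs. -/
structure Iso (Γ Δ : DirGraph) where
  /-- the bijection on vertices -/
  onV : Γ.V ≃ Δ.V
  /-- the bijection on edges -/
  onE : Γ.E ≃ Δ.E
  map_src : ∀ e, Δ.src (onE e) = onV (Γ.src e)
  map_rng : ∀ e, Δ.rng (onE e) = onV (Γ.rng e)

/-! ### Leavitt path algebras and Leavitt inverse semigroups -/

/-- The generators of the Leavitt path algebra: vertices `v`, edges `e` and inverse edges `e*`. -/
inductive Gen (Γ : DirGraph)
  | vertex (v : Γ.V)
  | edge (e : Γ.E)
  | ghost (e : Γ.E)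

namespace Gen

/-- The source of a generator: `s(v) = v` and `s(e*) = r(e)`. -/
def src {Γ : DirGraph} : Γ.Gen → Γ.V
  | vertex v => v
  | edge e => Γ.src e
  | ghost e => Γ.rng e

/-- The range of a generator: `r(v) = v` and `r(e*) = s(e)`. -/
def rng {Γ : DirGraph} : Γ.Gen → Γ.V
  | vertex v => v
  | edge e => Γ.rng e
  | ghost e => Γ.src e

end Gen

section Leavitt

variable (F : Type*) [Field F] (Γ : DirGraph)

/-- The free (associative, not necessarily unital) `F`-algebra on the generators. -/
abbrev FreeAlg : Type _ := MonoidAlgebra F (FreeSemigroup Γ.Gen)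

/-- A generator, as an element of the free algebra. -/
noncomputable def freeGen (x : Γ.Gen) : FreeAlg F Γ :=
  MonoidAlgebra.single (FreeSemigroup.of x) 1

open Gen in
/-- The defining relations of the Leavitt path algebra. The Cuntz-Krieger relation is imposed at
the vertices that emit a finite nonzero number of edges (in a row-finite graph: at the vertices
that are not sinks). -/
inductive LeavittRel : FreeAlg F Γ → FreeAlg F Γ → Prop
  | src_mul (x : Γ.Gen) :
      LeavittRel (freeGen F Γ (vertex x.src) * freeGen F Γ x) (freeGen F Γ x)
  | mul_rng (x : Γ.Gen) :
      LeavittRel (freeGen F Γ x * freeGen F Γ (vertex x.rng)) (freeGen F Γ x)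
  | vertex_mul (u v : Γ.V) (h : u ≠ v) :
      LeavittRel (freeGen F Γ (vertex u) * freeGen F Γ (vertex v)) 0
  | ghost_mul_edge_of_ne (e f : Γ.E) (h : e ≠ f) :
      LeavittRel (freeGen F Γ (ghost e) * freeGen F Γ (edge f)) 0
  | ghost_mul_edge (e : Γ.E) :
      LeavittRel (freeGen F Γ (ghost e) * freeGen F Γ (edge e)) (freeGen F Γ (vertex (Γ.rng e)))
  | cuntzKrieger (v : Γ.V) (hfin : {e : Γ.E | Γ.src e = v}.Finite)
      (hne : {e : Γ.E | Γ.src e = v}.Nonempty) :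
      LeavittRel (freeGen F Γ (vertex v))
        (∑ e ∈ hfin.toFinset, freeGen F Γ (edge e) * freeGen F Γ (ghost e))

/-- The algebra congruence generated by the defining relations. (As the free algebra has no unit,
closure under scalar multiplication has to be built in.) -/
noncomputable def leavittCon : RingCon (FreeAlg F Γ) :=
  ringConGen fun x y => ∃ (c : F) (a b : FreeAlg F Γ), LeavittRel F Γ a b ∧ x = c • a ∧ y = c • b

theorem leavittCon_smul (c : F) {x y : FreeAlg F Γ} (h : leavittCon F Γ x y) :
    leavittCon F Γ (c • x) (c • y) := by
  change RingConGen.Rel _ _ _ at h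
  change RingConGen.Rel _ _ _
  induction h with
  | of x y h =>
    obtain ⟨d, a, b, hab, rfl, rfl⟩ := h
    exact RingConGen.Rel.of _ _ ⟨c * d, a, b, hab, by rw [mul_smul], by rw [mul_smul]⟩
  | refl x => exact RingConGen.Rel.refl _
  | symm _ ih => exact ih.symm
  | trans _ _ ih₁ ih₂ => exact ih₁.trans ih₂
  | add _ _ ih₁ ih₂ => rw [smul_add, smul_add]; exact ih₁.add ih₂
  | mul _ h₂ ih₁ _ => rw [← smul_mul_assoc, ← smul_mul_assoc]; exact ih₁.mul h₂

/-- The Leavitt path algebra `L_F(Γ)`: the (not necessarily unital) `F`-algebra presented by the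
vertices, edges and inverse edges of `Γ`, subject to the defining relations. -/
def LeavittPathAlgebra : Type _ := (leavittCon F Γ).Quotient

namespace LeavittPathAlgebra

noncomputable instance : NonUnitalRing (LeavittPathAlgebra F Γ) :=
  inferInstanceAs (NonUnitalRing (leavittCon F Γ).Quotient)

/-- The quotient map from the free algebra. -/
noncomputable def mk (x : FreeAlg F Γ) : LeavittPathAlgebra F Γ := (leavittCon F Γ).toQuotient x

noncomputable instance : SMul F (LeavittPathAlgebra F Γ) :=
  ⟨(leavittCon F Γ).smulAux fun c _ _ h => leavittCon_smul F Γ c h⟩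

noncomputable instance : Module F (LeavittPathAlgebra F Γ) :=
  Function.Surjective.module F
    (⟨⟨mk F Γ, rfl⟩, fun _ _ => rfl⟩ : FreeAlg F Γ →+ LeavittPathAlgebra F Γ)
    Quotient.mk''_surjective (fun _ _ => rfl)

instance : IsScalarTower F (LeavittPathAlgebra F Γ) (LeavittPathAlgebra F Γ) where
  smul_assoc c x y := by
    obtain ⟨x, rfl⟩ := Quotient.mk''_surjective x
    obtain ⟨y, rfl⟩ := Quotient.mk''_surjective y
    exact congrArg (mk F Γ) (smul_mul_assoc c x y)

instance : SMulCommClass F (LeavittPathAlgebra F Γ) (LeavittPathAlgebra F Γ) where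
  smul_comm c x y := by
    obtain ⟨x, rfl⟩ := Quotient.mk''_surjective x
    obtain ⟨y, rfl⟩ := Quotient.mk''_surjective y
    exact congrArg (mk F Γ) (mul_smul_comm c x y).symm

/-- A vertex, edge or inverse edge, as an element of the Leavitt path algebra. -/
noncomputable def gen (x : Γ.Gen) : LeavittPathAlgebra F Γ := mk F Γ (freeGen F Γ x)

end LeavittPathAlgebra

/-- The Leavitt inverse semigroup `LI(Γ)`: the multiplicative subsemigroup, with zero, of the
Leavitt path algebra generated by the vertices, the edges and the inverse edges. -/
noncomputable def LeavittInverseSemigroup : Subsemigroup (LeavittPathAlgebra F Γ) :=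
  Subsemigroup.closure (insert 0 (Set.range (LeavittPathAlgebra.gen F Γ)))

end Leavitt

end DirGraph

/-!
Write `LI(Γ)` for the Leavitt inverse semigroup.
Its nonzero elements are the products `p q*` of a path `p` and the inverse of a path `q` with the
same range (`eq_zero_or_exists_of_mem`). They are told apart by a representation of the Leavitt
path algebra by partial bijections of a set of points lying over the vertices, on which an edge `e`
identifies the points over its range with a part of the points over its source, in such a way that
the edges from one vertex split the points over it into disjoint parts. A component in `ℤ` records
lengths of paths. It follows that `p q* = p' q'*` only if one of the pairs `(p, q)`, `(p', q')`
arises from the other one by appending an NE path (`exists_isNEPath_of_pe_mul_ps_eq`).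

*From the semigroup to the contraction.* The idempotents of `LI(Γ)` are `0` and the elements `p p*`.
So the vertices are the maximal idempotents, and an isomorphism of semigroups gives a bijection
`ψ` of vertices. Two vertices are equivalent exactly if they are related by Green's relation `𝒟`
(`greenD_vtx_iff`). The edges outside the trees from the class of `v` to the class of `w` can be
counted inside the semigroup: the edges with exits correspond to the idempotents directly below
`v` that are `𝒟`-related to `w` (`nonempty_equiv_submaximal`), and there is at most one
NE edge outside the trees, which is there if `v` and `w` are equivalent and the maximal subgroup at
`v` is nontrivial (`nonempty_equiv_plift`). Hence `ψ` extends to an isomorphism of the contractions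
for any choice of NE spanning trees. Such trees exist (`exists_neSpanningTrees`): an NE edge is
determined by its source, so the NE edges in a class form a tree after at most one edge has been
removed.

*From the contraction to the semigroup.* In a tree there is a well-defined element `treeElt` moving
from `v` to `w`, for equivalent vertices `v` and `w`. Sending a vertex to its image under `ψ`, a
tree edge to the passage inside the tree between the images of its ends, and any other edge to the
corresponding edge of the other contraction preceded and followed by such passages respects
the defining relations. The Cuntz-Krieger relation survives because all edges outside the trees
that start in a given class have the same source (`src_eq_src`). This gives ring homomorphisms in
both directions that are inverse to each other on generators, and they restrict to the
Leavitt inverse semigroups (`ContractionEquiv.mulEquiv`).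
-/

namespace DirGraph

/-! ### Paths with edges in a set -/

theorem isPath_nil_iff {Γ : DirGraph} {v w : Γ.V} : Γ.IsPath v [] w ↔ v = w :=
  ⟨fun h => by cases h; rfl, fun h => h ▸ IsPath.nil v⟩

theorem isPath_cons_iff {Γ : DirGraph} {v w : Γ.V} {e : Γ.E} {p : List Γ.E} :
    Γ.IsPath v (e :: p) w ↔ Γ.src e = v ∧ Γ.IsPath (Γ.rng e) p w :=
  ⟨fun h => by cases h with | cons _ h => exact ⟨rfl, h⟩, fun ⟨h, h'⟩ => h ▸ IsPath.cons e h'⟩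

theorem isPath_append_iff {Γ : DirGraph} {v w : Γ.V} {p q : List Γ.E} :
    Γ.IsPath v (p ++ q) w ↔ ∃ u, Γ.IsPath v p u ∧ Γ.IsPath u q w := by
  induction p generalizing v with
  | nil => simp [isPath_nil_iff]
  | cons e p ih => simp [isPath_cons_iff, ih, and_assoc]

/-- The list of edges `p` is a directed path from `v` to `w`, all of whose edges lie in `A`. -/
def IsPathIn (Γ : DirGraph) (A : Set Γ.E) (v : Γ.V) (p : List Γ.E) (w : Γ.V) : Prop :=
  Γ.IsPath v p w ∧ ∀ e ∈ p, e ∈ A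

/-- The set of NE edges. -/
def neEdges (Γ : DirGraph) : Set Γ.E := {e | Γ.IsNE e}

section PathIn

variable {Γ : DirGraph} {A : Set Γ.E}

theorem isPathIn_nil_iff {v w : Γ.V} : Γ.IsPathIn A v [] w ↔ v = w := by
  simp [IsPathIn, isPath_nil_iff]

theorem IsPathIn.nil (v : Γ.V) : Γ.IsPathIn A v [] v := isPathIn_nil_iff.2 rfl

theorem isPathIn_cons_iff {v w : Γ.V} {e : Γ.E} {p : List Γ.E} :
    Γ.IsPathIn A v (e :: p) w ↔ Γ.src e = v ∧ e ∈ A ∧ Γ.IsPathIn A (Γ.rng e) p w := by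
  simp only [IsPathIn, isPath_cons_iff, List.forall_mem_cons]; tauto

theorem isPathIn_append_iff {v w : Γ.V} {p q : List Γ.E} :
    Γ.IsPathIn A v (p ++ q) w ↔ ∃ u, Γ.IsPathIn A v p u ∧ Γ.IsPathIn A u q w := by
  simp only [IsPathIn, isPath_append_iff, List.forall_mem_append]
  constructor
  · rintro ⟨⟨u, h1, h2⟩, h3, h4⟩; exact ⟨u, ⟨h1, h3⟩, h2, h4⟩
  · rintro ⟨u, ⟨h1, h3⟩, h2, h4⟩; exact ⟨⟨u, h1, h2⟩, h3, h4⟩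

theorem IsPathIn.trans {u v w : Γ.V} {p q : List Γ.E} (h : Γ.IsPathIn A u p v)
    (h' : Γ.IsPathIn A v q w) : Γ.IsPathIn A u (p ++ q) w :=
  isPathIn_append_iff.2 ⟨v, h, h'⟩

theorem IsPathIn.mono {B : Set Γ.E} (hAB : A ⊆ B) {v w : Γ.V} {p : List Γ.E}
    (h : Γ.IsPathIn A v p w) : Γ.IsPathIn B v p w :=
  ⟨h.1, fun e he => hAB (h.2 e he)⟩

theorem IsPathIn.single {e : Γ.E} (he : e ∈ A) : Γ.IsPathIn A (Γ.src e) [e] (Γ.rng e) :=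
  isPathIn_cons_iff.2 ⟨rfl, he, IsPathIn.nil _⟩

theorem IsNE.eq_of_src_eq {e f : Γ.E} (he : Γ.IsNE e) (h : Γ.src f = Γ.src e) : f = e := by
  obtain ⟨x, hx⟩ := Set.encard_eq_one.1 he
  have he' : e ∈ ({x} : Set Γ.E) := hx ▸ (rfl : Γ.src e = Γ.src e)
  have hf' : f ∈ ({x} : Set Γ.E) := hx ▸ h
  exact (Set.mem_singleton_iff.1 hf').trans (Set.mem_singleton_iff.1 he').symm

theorem isNE_iff {e : Γ.E} : Γ.IsNE e ↔ ∀ f, Γ.src f = Γ.src e → f = e := by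
  refine ⟨fun h f hf => h.eq_of_src_eq hf, fun h => Set.encard_eq_one.2 ⟨e, ?_⟩⟩
  ext f
  exact ⟨fun hf => h f hf, fun hf => by rw [Set.mem_singleton_iff.1 hf]; rfl⟩

/-- A path without exits and an arbitrary path from the same vertex are comparable for the
prefix order. -/
theorem IsNEPath.prefix_or_prefix {v w w' : Γ.V} {p q : List Γ.E} (hp : Γ.IsNEPath v p w)
    (hq : Γ.IsPath v q w') :
    (∃ t, q = p ++ t ∧ Γ.IsPath w t w') ∨ ∃ t, p = q ++ t ∧ Γ.IsNEPath w' t w := by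
  induction p generalizing v q with
  | nil =>
    obtain rfl := isPathIn_nil_iff.1 hp
    exact Or.inl ⟨q, rfl, hq⟩
  | cons e p ih =>
    cases q with
    | nil =>
      obtain rfl := isPath_nil_iff.1 hq
      exact Or.inr ⟨e :: p, rfl, hp⟩
    | cons f q =>
      obtain ⟨rfl, he, hp₂⟩ := isPathIn_cons_iff.1 hp
      obtain ⟨hf, hq₂⟩ := isPath_cons_iff.1 hq
      obtain rfl := IsNE.eq_of_src_eq he hf
      rcases ih hp₂ hq₂ with ⟨t, rfl, ht⟩ | ⟨t, rfl, ht⟩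
      · exact Or.inl ⟨t, rfl, ht⟩
      · exact Or.inr ⟨t, rfl, ht⟩

theorem IsPathIn.prefix_or_prefix (hA : A ⊆ Γ.neEdges) {v w w' : Γ.V} {p q : List Γ.E}
    (hp : Γ.IsPathIn A v p w) (hq : Γ.IsPathIn A v q w') :
    (∃ t, q = p ++ t ∧ Γ.IsPathIn A w t w') ∨ ∃ t, p = q ++ t ∧ Γ.IsPathIn A w' t w := by
  rcases IsNEPath.prefix_or_prefix (hp.mono hA) hq.1 with ⟨t, rfl, ht⟩ | ⟨t, rfl, ht⟩
  · exact Or.inl ⟨t, rfl, ht, fun e he => hq.2 e (by simp [he])⟩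
  · exact Or.inr ⟨t, rfl, ht.1, fun e he => hp.2 e (by simp [he])⟩

/-- Two vertices are `A`-confluent if there are paths in `A` starting at them with the same
range. -/
def Confluent (Γ : DirGraph) (A : Set Γ.E) (v w : Γ.V) : Prop :=
  ∃ (p q : List Γ.E) (u : Γ.V), Γ.IsPathIn A v p u ∧ Γ.IsPathIn A w q u

theorem Confluent.refl (v : Γ.V) : Γ.Confluent A v v := ⟨[], [], v, .nil v, .nil v⟩

theorem Confluent.symm {v w : Γ.V} : Γ.Confluent A v w → Γ.Confluent A w v :=
  fun ⟨p, q, u, hp, hq⟩ => ⟨q, p, u, hq, hp⟩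

theorem Confluent.trans (hA : A ⊆ Γ.neEdges) {x y z : Γ.V} :
    Γ.Confluent A x y → Γ.Confluent A y z → Γ.Confluent A x z := by
  rintro ⟨p₁, q₁, w₁, hp₁, hq₁⟩ ⟨p₂, q₂, w₂, hp₂, hq₂⟩
  rcases hq₁.prefix_or_prefix hA hp₂ with ⟨t, -, ht⟩ | ⟨t, -, ht⟩
  · exact ⟨p₁ ++ t, q₂, w₂, hp₁.trans ht, hq₂⟩
  · exact ⟨p₁, q₂ ++ t, w₁, hp₁, hq₂.trans ht⟩

theorem cls_eq_iff {v w : Γ.V} : Γ.cls v = Γ.cls w ↔ Γ.NERel v w :=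
  ⟨fun h => Quotient.exact h, fun h => Quotient.sound h⟩

theorem IsPathIn.cls_eq (hA : A ⊆ Γ.neEdges) {v w : Γ.V} {p : List Γ.E}
    (h : Γ.IsPathIn A v p w) : Γ.cls v = Γ.cls w :=
  cls_eq_iff.2 ⟨p, [], w, h.mono hA, IsPathIn.nil w⟩

theorem IsNE.cls_rng {e : Γ.E} (he : Γ.IsNE e) : Γ.cls (Γ.rng e) = Γ.cls (Γ.src e) :=
  (IsPathIn.cls_eq subset_rfl (IsPathIn.single (A := Γ.neEdges) he)).symm

/-- From a vertex whose class contains a vertex `v` emitting no NE edge there is an NE path to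
`v`. -/
theorem exists_isNEPath_of_cls_eq {v w : Γ.V} (hv : ∀ e, Γ.src e = v → ¬Γ.IsNE e)
    (h : Γ.cls w = Γ.cls v) : ∃ p, Γ.IsNEPath w p v := by
  obtain ⟨p, q, u, hp, hq⟩ := cls_eq_iff.1 h
  cases q with
  | nil => obtain rfl := isPathIn_nil_iff.1 hq; exact ⟨p, hp⟩
  | cons e q => exact absurd (isPathIn_cons_iff.1 hq).2.1 (hv e (isPathIn_cons_iff.1 hq).1)

/-- If a vertex lies on a closed path in `A` and emits an NE edge, that edge lies in `A`, and so
does a closed path at its range. -/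
theorem IsPathIn.rotate {e : Γ.E} (he : Γ.IsNE e) {p : List Γ.E} (hp : p ≠ [])
    (h : Γ.IsPathIn A (Γ.src e) p (Γ.src e)) :
    e ∈ A ∧ ∃ q, p = e :: q ∧ Γ.IsPathIn A (Γ.rng e) q (Γ.src e) := by
  cases p with
  | nil => exact absurd rfl hp
  | cons f q =>
    obtain ⟨hf, hfA, hq⟩ := isPathIn_cons_iff.1 h
    obtain rfl := IsNE.eq_of_src_eq he hf
    exact ⟨hfA, q, rfl, hq⟩

/-- Nontrivial closed paths in `A` can be transported along NE paths. -/
theorem IsNEPath.exists_closed {v w : Γ.V} {m : List Γ.E} (hm : Γ.IsNEPath v m w)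
    (h : ∃ p, p ≠ [] ∧ Γ.IsPathIn A v p v) : ∃ p, p ≠ [] ∧ Γ.IsPathIn A w p w := by
  induction m generalizing v with
  | nil => obtain rfl := isPathIn_nil_iff.1 hm; exact h
  | cons e m ih =>
    obtain ⟨rfl, he, hm⟩ := isPathIn_cons_iff.1 hm
    obtain ⟨p, hp, hpp⟩ := h
    obtain ⟨heA, q, rfl, hq⟩ := hpp.rotate he hp
    exact ih hm ⟨q ++ [e], by simp, hq.trans (IsPathIn.single heA)⟩

/-- An NE path starting on a closed path in `A` can be continued in `A` back to its source. -/
theorem IsNEPath.exists_return {v w : Γ.V} {m : List Γ.E} (hm : Γ.IsNEPath v m w)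
    (h : ∃ p, p ≠ [] ∧ Γ.IsPathIn A v p v) : ∃ p, Γ.IsPathIn A w p v := by
  induction m generalizing v with
  | nil => obtain rfl := isPathIn_nil_iff.1 hm; exact ⟨[], .nil v⟩
  | cons e m ih =>
    obtain ⟨rfl, he, hm⟩ := isPathIn_cons_iff.1 hm
    obtain ⟨p, hp, hpp⟩ := h
    obtain ⟨heA, q, rfl, hq⟩ := hpp.rotate he hp
    obtain ⟨r, hr⟩ := ih hm ⟨q ++ [e], by simp, hq.trans (IsPathIn.single heA)⟩
    exact ⟨r ++ q, hr.trans hq⟩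

/-! ### Spanning trees consisting of NE edges -/

section Subgraph

variable {S : Set Γ.V} {h : ∀ e ∈ A, Γ.src e ∈ S ∧ Γ.rng e ∈ S}

theorem confluent_of_double_isPath (hA : A ⊆ Γ.neEdges) {v w : S} {p : List (A ⊕ A)}
    (hp : (Γ.subgraph S A h).double.IsPath v p w) : Γ.Confluent A v.1 w.1 := by
  induction p generalizing v with
  | nil => obtain rfl := isPath_nil_iff.1 hp; exact .refl _
  | cons e p ih =>
    obtain ⟨rfl, hp₂⟩ := isPath_cons_iff.1 hp
    refine Confluent.trans hA ?_ (ih hp₂)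
    rcases e with e | e
    · exact ⟨[e.1], [], _, .single e.2, .nil _⟩
    · exact ⟨[], [e.1], _, .nil _, .single e.2⟩

theorem IsPathIn.exists_double {v w : S} {p : List Γ.E} (hp : Γ.IsPathIn A v.1 p w.1) :
    ∃ p' : List A, (Γ.subgraph S A h).double.IsPath v (p'.map Sum.inl) w ∧
      p = p'.map Subtype.val := by
  induction p generalizing v with
  | nil =>
    obtain rfl := Subtype.ext (isPathIn_nil_iff.1 hp)
    exact ⟨[], IsPath.nil (Γ := (Γ.subgraph S A h).double) v, rfl⟩
  | cons e p ih =>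
    obtain ⟨hv, he, hp⟩ := isPathIn_cons_iff.1 hp
    obtain ⟨p', hp', rfl⟩ := ih (v := ⟨Γ.rng e, (h e he).2⟩) hp
    refine ⟨⟨e, he⟩ :: p', ?_, rfl⟩
    exact (isPath_cons_iff (Γ := (Γ.subgraph S A h).double) (e := Sum.inl ⟨e, he⟩)).2
      ⟨Subtype.ext hv, hp'⟩

theorem double_isPath_reverse {v w : Γ.V} {p : List (Γ.E ⊕ Γ.E)} (hp : Γ.double.IsPath v p w) :
    Γ.double.IsPath w (p.map Sum.swap).reverse v := by
  induction p generalizing v with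
  | nil => obtain rfl := isPath_nil_iff.1 hp; exact IsPath.nil (Γ := Γ.double) v
  | cons e p ih =>
    obtain ⟨rfl, hp₂⟩ := isPath_cons_iff.1 hp
    rw [List.map_cons, List.reverse_cons]
    refine (ih hp₂).append ?_
    rcases e with e | e
    · exact (isPath_cons_iff (Γ := Γ.double)).2 ⟨rfl, IsPath.nil (Γ := Γ.double) (Γ.src e)⟩
    · exact (isPath_cons_iff (Γ := Γ.double)).2 ⟨rfl, IsPath.nil (Γ := Γ.double) (Γ.rng e)⟩

theorem exists_isPathIn_of_forall_isLeft {v w : S} {p : List (A ⊕ A)}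
    (hp : (Γ.subgraph S A h).double.IsPath v p w) (hl : ∀ a ∈ p, a.isLeft) :
    ∃ q, Γ.IsPathIn A v.1 q w.1 ∧ q.length = p.length := by
  induction p generalizing v with
  | nil => exact ⟨[], isPathIn_nil_iff.2 (congrArg _ (isPath_nil_iff.1 hp)), rfl⟩
  | cons a p ih =>
    obtain ⟨hv, hp⟩ := isPath_cons_iff.1 hp
    obtain ⟨q, hq, hlen⟩ := ih hp fun b hb => hl b (List.mem_cons_of_mem _ hb)
    rcases a with e | e
    · exact ⟨e.1 :: q, isPathIn_cons_iff.2 ⟨congrArg Subtype.val hv, e.2, hq⟩, by simp [hlen]⟩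
    · simpa using hl (Sum.inr e) (by simp)

/-- A confluent set of NE edges without directed closed paths forms a tree. Indeed an edge read
backwards is never followed by an edge read forwards in a reduced path, for the two would have
the same source; so a reduced circuit is a directed closed path or the inverse of one. -/
theorem isTree_subgraph (hA : A ⊆ Γ.neEdges) (hconf : ∀ v ∈ S, ∀ w ∈ S, Γ.Confluent A v w)
    (hacyc : ∀ v p, Γ.IsPathIn A v p v → p = []) : (Γ.subgraph S A h).IsTree := by
  refine ⟨fun v w => ?_, fun v p hp => ?_⟩
  · obtain ⟨p, q, u, hp, hq⟩ := hconf v.1 v.2 w.1 w.2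
    have hu : u ∈ S := by
      clear hq
      obtain ⟨v, hv⟩ := v
      induction p generalizing v with
      | nil => exact isPathIn_nil_iff.1 hp ▸ hv
      | cons e p ih =>
        obtain ⟨-, he, hp⟩ := isPathIn_cons_iff.1 hp
        exact ih _ (h e he).2 hp
    obtain ⟨p', hp', -⟩ := IsPathIn.exists_double (h := h) (w := ⟨u, hu⟩) hp
    obtain ⟨q', hq', -⟩ := IsPathIn.exists_double (h := h) (w := ⟨u, hu⟩) hq
    exact ⟨_, hp'.append (double_isPath_reverse hq')⟩
  · obtain ⟨hpath, hchain, hcyc⟩ := hp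
    have hmono : ∀ {v w : S} {p : List (A ⊕ A)}, (Γ.subgraph S A h).double.IsPath v p w →
        p.IsChain (fun a b => a ≠ b.swap) → p.IsChain fun a b => a.isRight → b.isRight := by
      intro v w p hp hc
      induction p generalizing v with
      | nil => exact List.isChain_nil
      | cons a p ih =>
        cases p with
        | nil => exact List.isChain_singleton _
        | cons b p =>
          rw [List.isChain_cons_cons] at hc ⊢
          obtain ⟨-, hp⟩ := isPath_cons_iff.1 hp
          refine ⟨fun ha => ?_, ih hp hc.2⟩
          rcases a with e | e
          · simp at ha
          rcases b with f | f
          · obtain ⟨hf, -⟩ := isPath_cons_iff.1 hp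
            refine absurd ?_ hc.1
            exact congrArg Sum.inr (Subtype.ext (IsNE.eq_of_src_eq (hA f.2)
              (congrArg Subtype.val hf).symm))
          · rfl
    have hpw : p.Pairwise fun a b => a.isRight → b.isRight := by
      have key : ∀ l : List (A ⊕ A), l.IsChain (fun a b => a.isRight → b.isRight) →
          l.Pairwise fun a b => a.isRight → b.isRight := by
        intro l hl
        have : Trans (fun a b : A ⊕ A => a.isRight = true → b.isRight = true)
          (fun a b : A ⊕ A => a.isRight = true → b.isRight = true)
          fun a b : A ⊕ A => a.isRight = true → b.isRight = true := ⟨fun h h' => h' ∘ h⟩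
        exact List.isChain_iff_pairwise.1 hl
      exact key p (hmono hpath hchain)
    have hleft : ∀ {p : List (A ⊕ A)}, (Γ.subgraph S A h).double.IsPath v p v →
        (∀ a ∈ p, a.isLeft) → p = [] := by
      intro p hp hl
      obtain ⟨q, hq, hlen⟩ := exists_isPathIn_of_forall_isLeft hp hl
      rw [hacyc _ _ hq] at hlen
      exact List.length_eq_zero_iff.1 hlen.symm
    rcases p with - | ⟨a, p⟩
    · rfl
    rcases a with e | e
    · refine hleft hpath ?_
      rcases List.eq_nil_or_concat' (Sum.inl e :: p) with h0 | ⟨p', b, hb⟩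
      · simp at h0
      rw [hb] at hpath hpw hcyc ⊢
      have hbl : b.isLeft := by
        rcases b with f | f
        · rfl
        exfalso
        rw [← hb] at hcyc
        have h1 := hcyc (Sum.inl e) (by simp) (Sum.inr f) (by rw [hb]; simp)
        obtain ⟨u, -, h2⟩ := isPath_append_iff.1 hpath
        have h3 := isPath_nil_iff.1 (isPath_cons_iff.1 h2).2
        rw [← hb] at hpath
        have h4 := (isPath_cons_iff.1 hpath).1
        exact h1 (congrArg Sum.inl (Subtype.ext (IsNE.eq_of_src_eq (hA f.2)
          (congrArg Subtype.val (h4.trans h3.symm)))))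
      intro c hc
      rcases List.mem_append.1 hc with hc | hc
      · have := (List.pairwise_append.1 hpw).2.2 c hc b (by simp)
        rcases c with c | c
        · rfl
        · rcases b with b | b
          · exact absurd (this rfl) (by simp)
          · simp at hbl
      · rw [List.mem_singleton.1 hc]; exact hbl
    · have hr : ∀ a ∈ (Sum.inr e :: p : List (A ⊕ A)), a.isRight := by
        intro a ha
        rcases List.mem_cons.1 ha with rfl | ha
        · rfl
        · exact (List.pairwise_cons.1 hpw).1 a ha rfl
      have h1 := hleft (double_isPath_reverse hpath) (by
        intro a ha
        obtain ⟨b, hb, rfl⟩ := List.mem_map.1 (List.mem_reverse.1 ha)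
        have := hr b hb
        rcases b with b | b
        · cases this
        · rfl)
      cases List.map_eq_nil_iff.1 (List.reverse_eq_nil_iff.1 h1)

/-- A tree of NE edges contains no nontrivial directed closed path. -/
theorem IsTree.isPathIn_eq_nil (ht : (Γ.subgraph S A h).IsTree) {v : Γ.V} {p : List Γ.E}
    (hp : Γ.IsPathIn A v p v) : p = [] := by
  rcases p with - | ⟨e, p⟩
  · rfl
  have hv : v ∈ S := by
    obtain ⟨rfl, he, -⟩ := isPathIn_cons_iff.1 hp
    exact (h e he).1
  obtain ⟨p', hp', hpe⟩ := IsPathIn.exists_double (h := h) (v := ⟨v, hv⟩) (w := ⟨v, hv⟩) hp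
  have hswap : ∀ a ∈ p'.map (Sum.inl : A → A ⊕ A), ∀ b ∈ p'.map (Sum.inl : A → A ⊕ A),
      a ≠ b.swap := by
    intro a ha b hb
    obtain ⟨a, -, rfl⟩ := List.mem_map.1 ha
    obtain ⟨b, -, rfl⟩ := List.mem_map.1 hb
    simp
  have h0 := ht.2 ⟨v, hv⟩ _ ⟨hp', List.Pairwise.isChain (List.pairwise_of_forall_mem_list
    (fun a ha b hb => hswap a ha b hb)),
    fun a ha b hb => hswap a (List.mem_of_mem_head? ha) b (List.mem_of_mem_getLast? hb)⟩
  obtain rfl := List.map_eq_nil_iff.1 h0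
  exact hpe

end Subgraph

namespace NESpanningTrees

variable (T : Γ.NESpanningTrees)

/-- The set of all edges of the trees. -/
def treeEdges : Set Γ.E := {e | ∃ c, e ∈ T.edges c}

variable {T}

theorem treeEdges_subset : T.treeEdges ⊆ Γ.neEdges := fun e ⟨c, h⟩ => T.isNE c e h

theorem notMem_treeEdges {e : Γ.E} : e ∉ T.treeEdges ↔ ∀ c, e ∉ T.edges c := by
  simp [treeEdges]

theorem confluent {v w : Γ.V} (h : Γ.cls v = Γ.cls w) : Γ.Confluent T.treeEdges v w := by
  obtain ⟨p, hp⟩ := (T.isTree (Γ.cls w)).1 ⟨v, h⟩ ⟨w, rfl⟩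
  obtain ⟨p, q, u, hp, hq⟩ := confluent_of_double_isPath (T.isNE _) hp
  have hsub : T.edges (Γ.cls w) ⊆ T.treeEdges := fun e he => ⟨_, he⟩
  exact ⟨p, q, u, hp.mono hsub, hq.mono hsub⟩

theorem isPathIn_cls {v w : Γ.V} {p : List Γ.E} (hp : Γ.IsPathIn T.treeEdges v p w) :
    Γ.IsPathIn (T.edges (Γ.cls v)) v p w := by
  induction p generalizing v with
  | nil => obtain rfl := isPathIn_nil_iff.1 hp; exact .nil _
  | cons e p ih =>
    obtain ⟨rfl, he, hp⟩ := isPathIn_cons_iff.1 hp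
    refine isPathIn_cons_iff.2 ⟨rfl, ?_, ?_⟩
    · obtain ⟨c, hc⟩ := he
      obtain rfl := (T.ends_mem c e hc).1
      exact hc
    · rw [← IsNE.cls_rng (treeEdges_subset he)]
      exact ih hp

theorem acyclic {v : Γ.V} {p : List Γ.E} (hp : Γ.IsPathIn T.treeEdges v p v) : p = [] :=
  (T.isTree (Γ.cls v)).isPathIn_eq_nil (isPathIn_cls hp)

/-- Any two edges outside the trees whose sources are equivalent have the same source: in the
class there is at most one vertex not emitting an edge of the tree. -/
theorem src_eq_src {e f : Γ.E} (he : e ∉ T.treeEdges) (hf : f ∉ T.treeEdges)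
    (h : Γ.cls (Γ.src e) = Γ.cls (Γ.src f)) : Γ.src e = Γ.src f := by
  have key : ∀ {g : Γ.E} {p : List Γ.E} {u : Γ.V}, g ∉ T.treeEdges →
      Γ.IsPathIn T.treeEdges (Γ.src g) p u → Γ.src g = u := by
    intro g p u hg hp
    cases p with
    | nil => exact isPathIn_nil_iff.1 hp
    | cons a p =>
      obtain ⟨ha, haT, -⟩ := isPathIn_cons_iff.1 hp
      exact absurd (IsNE.eq_of_src_eq (treeEdges_subset haT) ha.symm ▸ haT) hg
  obtain ⟨p, q, u, hp, hq⟩ := T.confluent h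
  rw [key he hp, key hf hq]

end NESpanningTrees

/-- Every graph has a set of NE spanning trees. In a class containing a directed closed NE path,
the tree consists of all NE edges but one edge of the closed path; in any other class it consists
of all NE edges. -/
theorem exists_neSpanningTrees (Γ : DirGraph) : Nonempty Γ.NESpanningTrees := by
  have key : ∀ c : Γ.NEClass, ∃ A : Set Γ.E, A ⊆ Γ.neEdges ∧ (∀ e ∈ A, Γ.cls (Γ.src e) = c) ∧
      (∀ v w, Γ.cls v = c → Γ.cls w = c → Γ.Confluent A v w) ∧
      ∀ v p, Γ.IsPathIn A v p v → p = [] := by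
    intro c
    have hB : ∀ {v w p}, Γ.cls v = c → Γ.IsNEPath v p w →
        Γ.IsPathIn {e | Γ.IsNE e ∧ Γ.cls (Γ.src e) = c} v p w := by
      intro v w p hv hp
      induction p generalizing v with
      | nil => obtain rfl := isPathIn_nil_iff.1 hp; exact .nil _
      | cons e p ih =>
        obtain ⟨rfl, he, hp⟩ := isPathIn_cons_iff.1 hp
        exact isPathIn_cons_iff.2 ⟨rfl, ⟨he, hv⟩, ih ((IsNE.cls_rng he).trans hv) hp⟩
    by_cases hcyc : ∃ e₀ p₀, Γ.cls (Γ.src e₀) = c ∧ Γ.IsNEPath (Γ.src e₀) (e₀ :: p₀) (Γ.src e₀)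
    · obtain ⟨e₀, p₀, rfl, hp₀⟩ := hcyc
      have hto : ∀ v, Γ.cls v = Γ.cls (Γ.src e₀) → ∃ p, Γ.IsNEPath v p (Γ.src e₀) := by
        intro v hv
        obtain ⟨p, q, u, hp, hq⟩ := cls_eq_iff.1 hv
        obtain ⟨r, hr⟩ := hq.exists_return (A := Γ.neEdges) ⟨_, by simp, hp₀⟩
        exact ⟨_, hp.append hr⟩
      have hto' : ∀ v, Γ.cls v = Γ.cls (Γ.src e₀) → ∃ p, Γ.IsPathIn
          {e | Γ.IsNE e ∧ Γ.cls (Γ.src e) = Γ.cls (Γ.src e₀) ∧ e ≠ e₀} v p (Γ.src e₀) := by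
        intro v hv
        obtain ⟨p, hp⟩ := hto v hv
        clear hto
        induction p generalizing v with
        | nil => obtain rfl := isPathIn_nil_iff.1 hp; exact ⟨[], .nil _⟩
        | cons e p ih =>
          obtain ⟨rfl, he, hp⟩ := isPathIn_cons_iff.1 hp
          by_cases hee : e = e₀
          · exact ⟨[], by rw [hee]; exact .nil _⟩
          · obtain ⟨q, hq⟩ := ih _ ((IsNE.cls_rng he).trans hv) hp
            exact ⟨e :: q, isPathIn_cons_iff.2 ⟨rfl, ⟨he, hv, hee⟩, hq⟩⟩
      refine ⟨{e | Γ.IsNE e ∧ Γ.cls (Γ.src e) = Γ.cls (Γ.src e₀) ∧ e ≠ e₀}, fun e he => he.1,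
        fun e he => he.2.1, fun v w hv hw => ?_, fun v p hp => ?_⟩
      · obtain ⟨p, hp⟩ := hto' v hv
        obtain ⟨q, hq⟩ := hto' w hw
        exact ⟨p, q, _, hp, hq⟩
      · by_contra hne
        have hv : Γ.cls v = Γ.cls (Γ.src e₀) := by
          cases p with
          | nil => exact absurd rfl hne
          | cons e p =>
            obtain ⟨rfl, he, -⟩ := isPathIn_cons_iff.1 hp
            exact he.2.1
        obtain ⟨m, hm⟩ := hto v hv
        obtain ⟨q, hq, hqp⟩ := hm.exists_closed ⟨p, hne, hp⟩
        exact (hqp.rotate (isPathIn_cons_iff.1 hp₀).2.1 hq).1.2.2 rfl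
    · refine ⟨{e | Γ.IsNE e ∧ Γ.cls (Γ.src e) = c}, fun e he => he.1, fun e he => he.2,
        fun v w hv hw => ?_, fun v p hp => ?_⟩
      · obtain ⟨p, q, u, hp, hq⟩ := cls_eq_iff.1 (hv.trans hw.symm)
        exact ⟨p, q, u, hB hv hp, hB hw hq⟩
      · cases p with
        | nil => rfl
        | cons e p =>
          obtain ⟨rfl, he, -⟩ := isPathIn_cons_iff.1 hp
          exact absurd ⟨e, p, he.2, hp.mono fun _ h => h.1⟩ hcyc
  choose A hA hsrc hconf hacyc using key
  exact ⟨⟨A, fun c e he => ⟨hsrc c e he, (IsNE.cls_rng (hA c he)).trans (hsrc c e he)⟩,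
    fun c => isTree_subgraph (hA c) (fun v hv w hw => hconf c v w hv hw) (hacyc c),
    fun c e he => hA c he⟩⟩

end PathIn

/-! ### The universal property of the Leavitt path algebra -/

open Gen in
/-- A family of elements of a ring, indexed by the vertices, edges and inverse edges of `Γ`, that
satisfies the defining relations of the Leavitt path algebra. -/
structure IsLeavittFamily (Γ : DirGraph) {B : Type*} [NonUnitalRing B] (f : Γ.Gen → B) :
    Prop where
  src_mul : ∀ x, f (vertex x.src) * f x = f x
  mul_rng : ∀ x, f x * f (vertex x.rng) = f x
  vertex_mul : ∀ u v, u ≠ v → f (vertex u) * f (vertex v) = 0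
  ghost_mul_edge_of_ne : ∀ e g, e ≠ g → f (ghost e) * f (edge g) = 0
  ghost_mul_edge : ∀ e, f (ghost e) * f (edge e) = f (vertex (Γ.rng e))
  cuntzKrieger : ∀ (v : Γ.V) (hfin : {e : Γ.E | Γ.src e = v}.Finite),
    {e : Γ.E | Γ.src e = v}.Nonempty →
      f (vertex v) = ∑ e ∈ hfin.toFinset, f (edge e) * f (ghost e)

section Leavitt

variable {F : Type*} [Field F] {Γ : DirGraph}

theorem IsLeavittFamily.exists_lift {B : Type*} [NonUnitalRing B] [Module F B]
    [IsScalarTower F B B] [SMulCommClass F B B] {f : Γ.Gen → B} (hf : Γ.IsLeavittFamily f) :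
    ∃ φ : LeavittPathAlgebra F Γ →ₙ+* B, ∀ x, φ (LeavittPathAlgebra.gen F Γ x) = f x := by
  let g : FreeAlg F Γ →ₙₐ[F] B := MonoidAlgebra.liftMagma F (FreeSemigroup.lift f)
  have hg : ∀ x, g (freeGen F Γ x) = f x := fun x => by
    simp [g, freeGen, MonoidAlgebra.liftMagma]
  have hrel : ∀ {a b : FreeAlg F Γ}, LeavittRel F Γ a b → g a = g b := by
    intro a b h
    induction h with
    | src_mul x => simp only [map_mul, hg, hf.src_mul]
    | mul_rng x => simp only [map_mul, hg, hf.mul_rng]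
    | vertex_mul u v h => simp only [map_mul, hg, map_zero, hf.vertex_mul u v h]
    | ghost_mul_edge_of_ne e e' h =>
      simp only [map_mul, hg, map_zero, hf.ghost_mul_edge_of_ne e e' h]
    | ghost_mul_edge e => simp only [map_mul, hg, hf.ghost_mul_edge]
    | cuntzKrieger v hfin hne => simp only [map_sum, map_mul, hg, hf.cuntzKrieger v hfin hne]
  have hcon : ∀ a b : FreeAlg F Γ, leavittCon F Γ a b → g a = g b := by
    intro a b h
    change RingConGen.Rel _ _ _ at h
    induction h with
    | of x y h =>
      obtain ⟨c, a, b, hab, rfl, rfl⟩ := h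
      rw [map_smul, map_smul, hrel hab]
    | refl x => rfl
    | symm _ ih => exact ih.symm
    | trans _ _ ih₁ ih₂ => exact ih₁.trans ih₂
    | add _ _ ih₁ ih₂ => rw [map_add, map_add, ih₁, ih₂]
    | mul _ _ ih₁ ih₂ => rw [map_mul, map_mul, ih₁, ih₂]
  refine ⟨{ toFun := Quotient.lift g hcon, map_mul' := ?_, map_zero' := ?_, map_add' := ?_ },
    hg⟩
  · rintro ⟨x⟩ ⟨y⟩; exact map_mul g x y
  · exact map_zero g
  · rintro ⟨x⟩ ⟨y⟩; exact map_add g x y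

namespace LeavittPathAlgebra

theorem mk_eq_of_leavittRel {a b : FreeAlg F Γ} (h : LeavittRel F Γ a b) :
    mk F Γ a = mk F Γ b :=
  (RingCon.eq _).2 (RingConGen.Rel.of _ _ ⟨1, a, b, h, (one_smul _ _).symm, (one_smul _ _).symm⟩)

theorem mk_sum {ι : Type*} (s : Finset ι) (a : ι → FreeAlg F Γ) :
    mk F Γ (∑ i ∈ s, a i) = ∑ i ∈ s, mk F Γ (a i) :=
  map_sum (⟨⟨mk F Γ, rfl⟩, fun _ _ => rfl⟩ : FreeAlg F Γ →+ LeavittPathAlgebra F Γ) a s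

theorem isLeavittFamily_gen : Γ.IsLeavittFamily (gen F Γ) where
  src_mul x := mk_eq_of_leavittRel (.src_mul x)
  mul_rng x := mk_eq_of_leavittRel (.mul_rng x)
  vertex_mul u v h := mk_eq_of_leavittRel (.vertex_mul u v h)
  ghost_mul_edge_of_ne e f h := mk_eq_of_leavittRel (.ghost_mul_edge_of_ne e f h)
  ghost_mul_edge e := mk_eq_of_leavittRel (.ghost_mul_edge e)
  cuntzKrieger v hfin hne := by
    refine (mk_eq_of_leavittRel (.cuntzKrieger v hfin hne)).trans ?_
    rw [mk_sum]
    rfl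

variable (F Γ)

/-- A vertex, as an element of the Leavitt path algebra. -/
noncomputable abbrev vx (v : Γ.V) : LeavittPathAlgebra F Γ := gen F Γ (.vertex v)

/-- An edge, as an element of the Leavitt path algebra. -/
noncomputable abbrev ed (e : Γ.E) : LeavittPathAlgebra F Γ := gen F Γ (.edge e)

/-- An inverse edge, as an element of the Leavitt path algebra. -/
noncomputable abbrev gh (e : Γ.E) : LeavittPathAlgebra F Γ := gen F Γ (.ghost e)

variable {F Γ}

@[simp] theorem vx_mul_self (v : Γ.V) : vx F Γ v * vx F Γ v = vx F Γ v :=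
  isLeavittFamily_gen.src_mul (.vertex v)

theorem vx_mul_of_ne {v w : Γ.V} (h : v ≠ w) : vx F Γ v * vx F Γ w = 0 :=
  isLeavittFamily_gen.vertex_mul v w h

@[simp] theorem vx_mul_ed (e : Γ.E) : vx F Γ (Γ.src e) * ed F Γ e = ed F Γ e :=
  isLeavittFamily_gen.src_mul (.edge e)

@[simp] theorem ed_mul_vx (e : Γ.E) : ed F Γ e * vx F Γ (Γ.rng e) = ed F Γ e :=
  isLeavittFamily_gen.mul_rng (.edge e)

@[simp] theorem vx_mul_gh (e : Γ.E) : vx F Γ (Γ.rng e) * gh F Γ e = gh F Γ e :=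
  isLeavittFamily_gen.src_mul (.ghost e)

@[simp] theorem gh_mul_vx (e : Γ.E) : gh F Γ e * vx F Γ (Γ.src e) = gh F Γ e :=
  isLeavittFamily_gen.mul_rng (.ghost e)

@[simp] theorem gh_mul_ed (e : Γ.E) : gh F Γ e * ed F Γ e = vx F Γ (Γ.rng e) :=
  isLeavittFamily_gen.ghost_mul_edge e

theorem gh_mul_ed_of_ne {e f : Γ.E} (h : e ≠ f) : gh F Γ e * ed F Γ f = 0 :=
  isLeavittFamily_gen.ghost_mul_edge_of_ne e f h

/-- At an edge without exits the Cuntz-Krieger relation has a single summand. -/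
theorem ed_mul_gh_of_isNE {e : Γ.E} (he : Γ.IsNE e) :
    ed F Γ e * gh F Γ e = vx F Γ (Γ.src e) := by
  have hset : {f : Γ.E | Γ.src f = Γ.src e} = {e} := by
    ext f
    exact ⟨fun h => he.eq_of_src_eq h, fun h => by rw [Set.mem_singleton_iff.1 h]; rfl⟩
  have hfin : {f : Γ.E | Γ.src f = Γ.src e}.Finite := by rw [hset]; exact Set.finite_singleton e
  have := (isLeavittFamily_gen (F := F) (Γ := Γ)).cuntzKrieger (Γ.src e) hfin ⟨e, rfl⟩
  have hs : hfin.toFinset = {e} := by ext f; simp [Set.ext_iff] at hset ⊢; exact hset f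
  rw [hs, Finset.sum_singleton] at this
  exact this.symm

/-! ### Paths in the Leavitt path algebra -/

variable (F Γ)

/-- The element of the Leavitt path algebra given by a path `p` with source `v`. -/
noncomputable def pe : Γ.V → List Γ.E → LeavittPathAlgebra F Γ
  | v, [] => vx F Γ v
  | _, e :: p => ed F Γ e * pe (Γ.rng e) p

/-- The element `p*` of the Leavitt path algebra, for a path `p` with source `v`. -/
noncomputable def ps : Γ.V → List Γ.E → LeavittPathAlgebra F Γ
  | v, [] => vx F Γ v
  | _, e :: p => ps (Γ.rng e) p * gh F Γ e

variable {F Γ}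

@[simp] theorem pe_nil (v : Γ.V) : pe F Γ v [] = vx F Γ v := rfl

@[simp] theorem ps_nil (v : Γ.V) : ps F Γ v [] = vx F Γ v := rfl

theorem pe_cons (v : Γ.V) (e : Γ.E) (p : List Γ.E) :
    pe F Γ v (e :: p) = ed F Γ e * pe F Γ (Γ.rng e) p := rfl

theorem ps_cons (v : Γ.V) (e : Γ.E) (p : List Γ.E) :
    ps F Γ v (e :: p) = ps F Γ (Γ.rng e) p * gh F Γ e := rfl

@[simp] theorem pe_singleton (v : Γ.V) (e : Γ.E) : pe F Γ v [e] = ed F Γ e := by simp [pe_cons]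

@[simp] theorem ps_singleton (v : Γ.V) (e : Γ.E) : ps F Γ v [e] = gh F Γ e := by simp [ps_cons]

theorem vx_mul_pe {v w : Γ.V} {p : List Γ.E} (hp : Γ.IsPath v p w) :
    vx F Γ v * pe F Γ v p = pe F Γ v p := by
  cases hp with
  | nil v => simp
  | cons e _ => rw [pe_cons, ← mul_assoc, vx_mul_ed]

theorem pe_mul_vx {v w : Γ.V} {p : List Γ.E} (hp : Γ.IsPath v p w) :
    pe F Γ v p * vx F Γ w = pe F Γ v p := by
  induction hp with
  | nil v => simp
  | cons e _ ih => rw [pe_cons, mul_assoc, ih]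

theorem ps_mul_vx {v w : Γ.V} {p : List Γ.E} (hp : Γ.IsPath v p w) :
    ps F Γ v p * vx F Γ v = ps F Γ v p := by
  cases hp with
  | nil v => simp
  | cons e _ => rw [ps_cons, mul_assoc, gh_mul_vx]

theorem vx_mul_ps {v w : Γ.V} {p : List Γ.E} (hp : Γ.IsPath v p w) :
    vx F Γ w * ps F Γ v p = ps F Γ v p := by
  induction hp with
  | nil v => simp
  | cons e _ ih => rw [ps_cons, ← mul_assoc, ih]

theorem pe_append {u v w : Γ.V} {p q : List Γ.E} (hp : Γ.IsPath u p v) (hq : Γ.IsPath v q w) :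
    pe F Γ u (p ++ q) = pe F Γ u p * pe F Γ v q := by
  induction hp with
  | nil v => simp [vx_mul_pe hq]
  | cons e _ ih => rw [List.cons_append, pe_cons, pe_cons, ih hq, mul_assoc]

theorem ps_append {u v w : Γ.V} {p q : List Γ.E} (hp : Γ.IsPath u p v) (hq : Γ.IsPath v q w) :
    ps F Γ u (p ++ q) = ps F Γ v q * ps F Γ u p := by
  induction hp with
  | nil v => simp [ps_mul_vx hq]
  | cons e _ ih => rw [List.cons_append, ps_cons, ps_cons, ih hq, mul_assoc]

theorem ps_mul_pe {v w : Γ.V} {p : List Γ.E} (hp : Γ.IsPath v p w) :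
    ps F Γ v p * pe F Γ v p = vx F Γ w := by
  induction hp with
  | nil v => simp
  | cons e h ih =>
    rw [ps_cons, pe_cons, mul_assoc, ← mul_assoc (gh F Γ e), gh_mul_ed, vx_mul_pe h, ih]

theorem pe_mul_ps_of_isNEPath {v w : Γ.V} {p : List Γ.E} (hp : Γ.IsNEPath v p w) :
    pe F Γ v p * ps F Γ v p = vx F Γ v := by
  induction p generalizing v with
  | nil => simp
  | cons e p ih =>
    obtain ⟨rfl, he, hp⟩ := isPathIn_cons_iff.1 hp
    rw [pe_cons, ps_cons, mul_assoc, ← mul_assoc (pe F Γ _ p), ih hp, vx_mul_gh,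
      ed_mul_gh_of_isNE he]

/-- The product `p* q` of the inverse of a path and a path vanishes unless one of the two paths
is a prefix of the other. -/
theorem prefix_or_ps_mul_pe_eq_zero {v w v' w' : Γ.V} {p q : List Γ.E} (hp : Γ.IsPath v p w)
    (hq : Γ.IsPath v' q w') :
    v = v' ∧ ((∃ t, q = p ++ t ∧ Γ.IsPath w t w') ∨ ∃ t, p = q ++ t ∧ Γ.IsPath w' t w) ∨
      ps F Γ v p * pe F Γ v' q = 0 := by
  by_cases hv : v = v'
  swap
  · right
    rw [← ps_mul_vx hp, ← vx_mul_pe hq, mul_assoc, ← mul_assoc (vx F Γ v), vx_mul_of_ne hv]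
    simp
  subst hv
  induction p generalizing v q with
  | nil => obtain rfl := isPath_nil_iff.1 hp; exact Or.inl ⟨rfl, Or.inl ⟨q, rfl, hq⟩⟩
  | cons e p ih =>
    cases q with
    | nil => obtain rfl := isPath_nil_iff.1 hq; exact Or.inl ⟨rfl, Or.inr ⟨e :: p, rfl, hp⟩⟩
    | cons f q =>
      obtain ⟨he, hp₂⟩ := isPath_cons_iff.1 hp
      obtain ⟨hf, hq₂⟩ := isPath_cons_iff.1 hq
      by_cases hef : e = f
      · subst hef
        rcases ih hp₂ hq₂ with ⟨-, ⟨t, rfl, ht⟩ | ⟨t, rfl, ht⟩⟩ | h0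
        · exact Or.inl ⟨rfl, Or.inl ⟨t, rfl, ht⟩⟩
        · exact Or.inl ⟨rfl, Or.inr ⟨t, rfl, ht⟩⟩
        · right
          rw [ps_cons, pe_cons, mul_assoc, ← mul_assoc (gh F Γ e), gh_mul_ed, vx_mul_pe hq₂, h0]
      · right
        rw [ps_cons, pe_cons, mul_assoc, ← mul_assoc (gh F Γ e), gh_mul_ed_of_ne hef]
        simp

/-! ### Elements of the Leavitt inverse semigroup -/

theorem gen_mem (x : Γ.Gen) : gen F Γ x ∈ LeavittInverseSemigroup F Γ :=
  Subsemigroup.subset_closure (Or.inr ⟨x, rfl⟩)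

theorem zero_mem : (0 : LeavittPathAlgebra F Γ) ∈ LeavittInverseSemigroup F Γ :=
  Subsemigroup.subset_closure (Or.inl rfl)

theorem pe_mem (v : Γ.V) (p : List Γ.E) : pe F Γ v p ∈ LeavittInverseSemigroup F Γ := by
  induction p generalizing v with
  | nil => exact gen_mem _
  | cons e p ih => exact mul_mem (gen_mem _) (ih _)

theorem ps_mem (v : Γ.V) (p : List Γ.E) : ps F Γ v p ∈ LeavittInverseSemigroup F Γ := by
  induction p generalizing v with
  | nil => exact gen_mem _
  | cons e p ih => exact mul_mem (ih _) (gen_mem _)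

/-- Every element of the Leavitt inverse semigroup is zero or of the form `p q*`, for paths `p`
and `q` with the same range. -/
theorem eq_zero_or_exists_of_mem {x : LeavittPathAlgebra F Γ}
    (hx : x ∈ LeavittInverseSemigroup F Γ) :
    x = 0 ∨ ∃ v p u q w, Γ.IsPath v p w ∧ Γ.IsPath u q w ∧ x = pe F Γ v p * ps F Γ u q := by
  induction hx using Subsemigroup.closure_induction with
  | mem x hx =>
    rcases hx with rfl | ⟨x | e | e, rfl⟩
    · exact Or.inl rfl
    · exact Or.inr ⟨x, [], x, [], x, .nil x, .nil x, by simp⟩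
    · exact Or.inr ⟨_, [e], _, [], _, .cons e (.nil _), .nil _, by simp⟩
    · exact Or.inr ⟨_, [], _, [e], _, .nil _, .cons e (.nil _), by simp⟩
  | mul x y hx hy ihx ihy =>
    rcases ihx with rfl | ⟨v, p, u, q, w, hp, hq, rfl⟩
    · exact Or.inl (zero_mul y)
    rcases ihy with rfl | ⟨v', p', u', q', w', hp', hq', rfl⟩
    · exact Or.inl (mul_zero _)
    rw [mul_assoc, ← mul_assoc (ps F Γ u q)]
    rcases prefix_or_ps_mul_pe_eq_zero (F := F) hq hp' with
      ⟨rfl, ⟨t, rfl, ht⟩ | ⟨t, rfl, ht⟩⟩ | h0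
    · refine Or.inr ⟨v, p ++ t, u', q', w', hp.append ht, hq', ?_⟩
      rw [pe_append hq ht, ← mul_assoc (ps F Γ u q), ps_mul_pe hq, vx_mul_pe ht, pe_append hp ht,
        mul_assoc]
    · refine Or.inr ⟨v, p, u', q' ++ t, w, hp, hq'.append ht, ?_⟩
      rw [ps_append hp' ht, mul_assoc (ps F Γ w' t), ps_mul_pe hp', ps_mul_vx ht,
        ps_append hq' ht]
    · left; rw [h0, zero_mul, mul_zero]

end LeavittPathAlgebra

end Leavitt

/-! ### Moving along the trees -/

section Tree

open LeavittPathAlgebra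

variable (F : Type*) [Field F] {Γ : DirGraph} (T : Γ.NESpanningTrees)

open Classical in
/-- For equivalent vertices `v` and `w`, the element `p q*` for any paths `p` and `q` in the tree
from `v` and `w` to a common vertex; it represents the passage from `v` to `w` inside the tree.
(The value for inequivalent vertices is irrelevant.) -/
noncomputable def treeElt (v w : Γ.V) : LeavittPathAlgebra F Γ :=
  if h : Γ.Confluent T.treeEdges v w then
    pe F Γ v h.choose * ps F Γ w h.choose_spec.choose else 0

variable {F T}

/-- The element `p q*` does not depend on the tree paths `p` and `q` with the same range: two
choices of `p` differ by a final segment, by which, due to acyclicity, the two choices of `q` differ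
as well, and this segment cancels because it is an NE path. -/
theorem pe_mul_ps_eq_of_isPathIn_treeEdges {v w x x' : Γ.V} {p q p' q' : List Γ.E}
    (hp : Γ.IsPathIn T.treeEdges v p x) (hq : Γ.IsPathIn T.treeEdges w q x)
    (hp' : Γ.IsPathIn T.treeEdges v p' x') (hq' : Γ.IsPathIn T.treeEdges w q' x') :
    pe F Γ v p * ps F Γ w q = pe F Γ v p' * ps F Γ w q' := by
  wlog h : ∃ t, p' = p ++ t ∧ Γ.IsPathIn T.treeEdges x t x' generalizing p q p' q' x x'
  · rcases hp.prefix_or_prefix NESpanningTrees.treeEdges_subset hp' with h' | h'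
    · exact absurd h' h
    · exact (this hp' hq' hp hq h').symm
  obtain ⟨t, rfl, ht⟩ := h
  have hqt : q' = q ++ t := by
    rcases (hq.trans ht).prefix_or_prefix NESpanningTrees.treeEdges_subset hq' with
      ⟨s, hs, hsp⟩ | ⟨s, hs, hsp⟩
    · rw [hs, T.acyclic hsp, List.append_nil]
    · rw [hs, T.acyclic hsp, List.append_nil]
  rw [hqt, pe_append hp.1 ht.1, ps_append hq.1 ht.1, mul_assoc, ← mul_assoc (pe F Γ x t),
    pe_mul_ps_of_isNEPath (ht.mono NESpanningTrees.treeEdges_subset), vx_mul_ps hq.1]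

theorem treeElt_eq {v w x : Γ.V} {p q : List Γ.E} (hp : Γ.IsPathIn T.treeEdges v p x)
    (hq : Γ.IsPathIn T.treeEdges w q x) : treeElt F T v w = pe F Γ v p * ps F Γ w q := by
  have h : Γ.Confluent T.treeEdges v w := ⟨p, q, x, hp, hq⟩
  rw [treeElt, dif_pos h]
  obtain ⟨x', hp', hq'⟩ := h.choose_spec.choose_spec
  exact pe_mul_ps_eq_of_isPathIn_treeEdges hp' hq' hp hq

@[simp] theorem treeElt_self (v : Γ.V) : treeElt F T v v = vx F Γ v := by
  simp [treeElt_eq (F := F) (T := T) (IsPathIn.nil v) (IsPathIn.nil v)]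

theorem treeElt_mul {v w u : Γ.V} (hvw : Γ.cls v = Γ.cls w) (hwu : Γ.cls w = Γ.cls u) :
    treeElt F T v w * treeElt F T w u = treeElt F T v u := by
  obtain ⟨p, q, x, hp, hq⟩ := T.confluent hvw
  obtain ⟨q', r, y, hq', hr⟩ := T.confluent hwu
  rw [treeElt_eq hp hq, treeElt_eq hq' hr, mul_assoc, ← mul_assoc (ps F Γ w q)]
  rcases hq.prefix_or_prefix NESpanningTrees.treeEdges_subset hq' with
    ⟨t, rfl, ht⟩ | ⟨t, rfl, ht⟩
  · rw [pe_append hq.1 ht.1, ← mul_assoc (ps F Γ w q), ps_mul_pe hq.1, vx_mul_pe ht.1,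
      treeElt_eq (hp.trans ht) hr, pe_append hp.1 ht.1, mul_assoc]
  · rw [ps_append hq'.1 ht.1, mul_assoc (ps F Γ y t), ps_mul_pe hq'.1, ps_mul_vx ht.1,
      treeElt_eq hp (hr.trans ht), ps_append hr.1 ht.1]

theorem vx_mul_treeElt {v w : Γ.V} (h : Γ.cls v = Γ.cls w) :
    vx F Γ v * treeElt F T v w = treeElt F T v w := by
  rw [← treeElt_self (T := T), treeElt_mul rfl h]

theorem treeElt_mul_vx {v w : Γ.V} (h : Γ.cls v = Γ.cls w) :
    treeElt F T v w * vx F Γ w = treeElt F T v w := by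
  rw [← treeElt_self (T := T) w, treeElt_mul h rfl]

theorem treeElt_edge {e : Γ.E} (he : e ∈ T.treeEdges) :
    treeElt F T (Γ.src e) (Γ.rng e) = ed F Γ e := by
  simp [treeElt_eq (F := F) (IsPathIn.single he) (IsPathIn.nil (Γ.rng e))]

theorem treeElt_ghost {e : Γ.E} (he : e ∈ T.treeEdges) :
    treeElt F T (Γ.rng e) (Γ.src e) = gh F Γ e := by
  simp [treeElt_eq (F := F) (IsPathIn.nil (Γ.rng e)) (IsPathIn.single he)]

theorem treeElt_mem {v w : Γ.V} (h : Γ.cls v = Γ.cls w) :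
    treeElt F T v w ∈ LeavittInverseSemigroup F Γ := by
  obtain ⟨p, q, x, hp, hq⟩ := T.confluent h
  rw [treeElt_eq hp hq]
  exact mul_mem (pe_mem _ _) (ps_mem _ _)

end Tree

/-! ### Isomorphic contractions give isomorphic semigroups -/

/-- A bijection between the vertices of two graphs that is compatible with the equivalence
relations, and a bijection between the edges outside the trees that is compatible with it. This
is the same as an isomorphism of the contracted graphs together with a lifting of its action on
vertices to a bijection between the vertices of the graphs themselves. -/
structure ContractionEquiv {Γ Δ : DirGraph} (T : Γ.NESpanningTrees)
    (T' : Δ.NESpanningTrees) where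
  /-- the bijection on vertices -/
  onV : Γ.V ≃ Δ.V
  /-- the bijection on edges outside the trees -/
  onE : {e : Γ.E // e ∉ T.treeEdges} ≃ {e : Δ.E // e ∉ T'.treeEdges}
  cls_iff : ∀ v w, Δ.cls (onV v) = Δ.cls (onV w) ↔ Γ.cls v = Γ.cls w
  cls_src : ∀ e, Δ.cls (Δ.src (onE e)) = Δ.cls (onV (Γ.src e))
  cls_rng : ∀ e, Δ.cls (Δ.rng (onE e)) = Δ.cls (onV (Γ.rng e))

namespace ContractionEquiv

open LeavittPathAlgebra

variable {F : Type*} [Field F] {Γ Δ : DirGraph} {T : Γ.NESpanningTrees} {T' : Δ.NESpanningTrees}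

/-- The inverse of a contraction equivalence. -/
def symm (D : ContractionEquiv T T') : ContractionEquiv T' T where
  onV := D.onV.symm
  onE := D.onE.symm
  cls_iff v w := by rw [← D.cls_iff, D.onV.apply_symm_apply, D.onV.apply_symm_apply]
  cls_src e := by
    rw [← D.cls_iff, ← D.cls_src, D.onE.apply_symm_apply, D.onV.apply_symm_apply]
  cls_rng e := by
    rw [← D.cls_iff, ← D.cls_rng, D.onE.apply_symm_apply, D.onV.apply_symm_apply]

theorem nonempty_iff : Nonempty (ContractionEquiv T T') ↔
    ∃ (ψ : Γ.V ≃ Δ.V) (φ : DirGraph.Iso (Γ.contract T) (Δ.contract T')),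
      ∀ v : Γ.V, φ.onV (Γ.contractV T v) = Δ.contractV T' (ψ v) := by
  constructor
  · rintro ⟨D⟩
    let eE : (Γ.contract T).E ≃ (Δ.contract T').E :=
      ((Equiv.subtypeEquivRight fun _ => NESpanningTrees.notMem_treeEdges).symm.trans D.onE).trans
        (Equiv.subtypeEquivRight fun _ => NESpanningTrees.notMem_treeEdges)
    refine ⟨D.onV, ⟨Quotient.congr D.onV fun v w => ?_, eE, fun e => ?_, fun e => ?_⟩,
      fun v => rfl⟩
    · exact cls_eq_iff.symm.trans ((D.cls_iff v w).symm.trans cls_eq_iff)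
    · exact D.cls_src ⟨e.1, NESpanningTrees.notMem_treeEdges.2 e.2⟩
    · exact D.cls_rng ⟨e.1, NESpanningTrees.notMem_treeEdges.2 e.2⟩
  · rintro ⟨ψ, φ, h⟩
    let eE : {e : Γ.E // e ∉ T.treeEdges} ≃ {e : Δ.E // e ∉ T'.treeEdges} :=
      ((Equiv.subtypeEquivRight fun _ => NESpanningTrees.notMem_treeEdges).trans φ.onE).trans
        (Equiv.subtypeEquivRight fun _ => NESpanningTrees.notMem_treeEdges).symm
    refine ⟨⟨ψ, eE, fun v w => ?_, fun e => ?_, fun e => ?_⟩⟩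
    · exact ((Eq.congr (h v) (h w)).symm.trans φ.onV.apply_eq_iff_eq :)
    · exact (φ.map_src ⟨e.1, NESpanningTrees.notMem_treeEdges.1 e.2⟩).trans (h _)
    · exact (φ.map_rng ⟨e.1, NESpanningTrees.notMem_treeEdges.1 e.2⟩).trans (h _)

variable (F) (D : ContractionEquiv T T')

open Classical in
/-- The image of a generator: a tree edge is sent to the tree path joining the images of its
ends, any other edge `e` to its image `e'` preceded and followed by tree paths. -/
noncomputable def genMap : Γ.Gen → LeavittPathAlgebra F Δ
  | .vertex v => vx F Δ (D.onV v)
  | .edge e => if h : e ∈ T.treeEdges then treeElt F T' (D.onV (Γ.src e)) (D.onV (Γ.rng e)) else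
      treeElt F T' (D.onV (Γ.src e)) (Δ.src (D.onE ⟨e, h⟩)) * ed F Δ (D.onE ⟨e, h⟩) *
        treeElt F T' (Δ.rng (D.onE ⟨e, h⟩)) (D.onV (Γ.rng e))
  | .ghost e => if h : e ∈ T.treeEdges then treeElt F T' (D.onV (Γ.rng e)) (D.onV (Γ.src e)) else
      treeElt F T' (D.onV (Γ.rng e)) (Δ.rng (D.onE ⟨e, h⟩)) * gh F Δ (D.onE ⟨e, h⟩) *
        treeElt F T' (Δ.src (D.onE ⟨e, h⟩)) (D.onV (Γ.src e))

variable {F}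

theorem genMap_edge_of_mem {e : Γ.E} (h : e ∈ T.treeEdges) :
    D.genMap F (.edge e) = treeElt F T' (D.onV (Γ.src e)) (D.onV (Γ.rng e)) := dif_pos h

theorem genMap_ghost_of_mem {e : Γ.E} (h : e ∈ T.treeEdges) :
    D.genMap F (.ghost e) = treeElt F T' (D.onV (Γ.rng e)) (D.onV (Γ.src e)) := dif_pos h

theorem genMap_edge_of_notMem {e : Γ.E} (h : e ∉ T.treeEdges) :
    D.genMap F (.edge e) = treeElt F T' (D.onV (Γ.src e)) (Δ.src (D.onE ⟨e, h⟩)) *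
      ed F Δ (D.onE ⟨e, h⟩) * treeElt F T' (Δ.rng (D.onE ⟨e, h⟩)) (D.onV (Γ.rng e)) := dif_neg h

theorem genMap_ghost_of_notMem {e : Γ.E} (h : e ∉ T.treeEdges) :
    D.genMap F (.ghost e) = treeElt F T' (D.onV (Γ.rng e)) (Δ.rng (D.onE ⟨e, h⟩)) *
      gh F Δ (D.onE ⟨e, h⟩) * treeElt F T' (Δ.src (D.onE ⟨e, h⟩)) (D.onV (Γ.src e)) := dif_neg h

theorem cls_onV_rng {e : Γ.E} (h : e ∈ T.treeEdges) :
    Δ.cls (D.onV (Γ.rng e)) = Δ.cls (D.onV (Γ.src e)) :=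
  (D.cls_iff _ _).2 (IsNE.cls_rng (NESpanningTrees.treeEdges_subset h))

theorem genMap_src_mul (x : Γ.Gen) :
    D.genMap F (.vertex x.src) * D.genMap F x = D.genMap F x := by
  rcases x with v | e | e
  · exact vx_mul_self _
  · by_cases h : e ∈ T.treeEdges
    · rw [D.genMap_edge_of_mem h]; exact vx_mul_treeElt (D.cls_onV_rng h).symm
    · rw [D.genMap_edge_of_notMem h, ← mul_assoc, ← mul_assoc]
      exact congrArg (· * _ * _) (vx_mul_treeElt (D.cls_src ⟨e, h⟩).symm)
  · by_cases h : e ∈ T.treeEdges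
    · rw [D.genMap_ghost_of_mem h]; exact vx_mul_treeElt (D.cls_onV_rng h)
    · rw [D.genMap_ghost_of_notMem h, ← mul_assoc, ← mul_assoc]
      exact congrArg (· * _ * _) (vx_mul_treeElt (D.cls_rng ⟨e, h⟩).symm)

theorem genMap_mul_rng (x : Γ.Gen) :
    D.genMap F x * D.genMap F (.vertex x.rng) = D.genMap F x := by
  rcases x with v | e | e
  · exact vx_mul_self _
  · by_cases h : e ∈ T.treeEdges
    · rw [D.genMap_edge_of_mem h]; exact treeElt_mul_vx (D.cls_onV_rng h).symm
    · rw [D.genMap_edge_of_notMem h, mul_assoc]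
      exact congrArg (_ * ·) (treeElt_mul_vx (D.cls_rng ⟨e, h⟩))
  · by_cases h : e ∈ T.treeEdges
    · rw [D.genMap_ghost_of_mem h]; exact treeElt_mul_vx (D.cls_onV_rng h)
    · rw [D.genMap_ghost_of_notMem h, mul_assoc]
      exact congrArg (_ * ·) (treeElt_mul_vx (D.cls_src ⟨e, h⟩))

/-- Edges outside the trees with the same source have images with the same source. -/
theorem src_onE_eq {e f : Γ.E} (he : e ∉ T.treeEdges) (hf : f ∉ T.treeEdges)
    (h : Γ.src e = Γ.src f) : Δ.src (D.onE ⟨e, he⟩) = Δ.src (D.onE ⟨f, hf⟩) :=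
  NESpanningTrees.src_eq_src (D.onE ⟨e, he⟩).2 (D.onE ⟨f, hf⟩).2
    ((D.cls_src _).trans ((congrArg (fun v => Δ.cls (D.onV v)) h).trans (D.cls_src ⟨f, hf⟩).symm))

theorem genMap_ghost_mul_edge_of_ne {e f : Γ.E} (hef : e ≠ f) :
    D.genMap F (.ghost e) * D.genMap F (.edge f) = 0 := by
  by_cases hs : Γ.src e = Γ.src f
  · have he : e ∉ T.treeEdges := fun h =>
      hef (IsNE.eq_of_src_eq (NESpanningTrees.treeEdges_subset h) hs.symm).symm
    have hf : f ∉ T.treeEdges := fun h =>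
      hef (IsNE.eq_of_src_eq (NESpanningTrees.treeEdges_subset h) hs)
    have h1 : treeElt F T' (Δ.src (D.onE ⟨e, he⟩)) (D.onV (Γ.src e)) *
        treeElt F T' (D.onV (Γ.src f)) (Δ.src (D.onE ⟨f, hf⟩)) =
          vx F Δ (Δ.src (D.onE ⟨e, he⟩)) := by
      rw [← hs, treeElt_mul (D.cls_src ⟨e, he⟩), ← D.src_onE_eq he hf hs, treeElt_self]
      rw [← D.src_onE_eq he hf hs]; exact (D.cls_src ⟨e, he⟩).symm
    have h2 : gh F Δ (D.onE ⟨e, he⟩).1 * ed F Δ (D.onE ⟨f, hf⟩).1 = 0 :=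
      gh_mul_ed_of_ne fun h => hef (by simpa using D.onE.injective (Subtype.ext h))
    rw [D.genMap_ghost_of_notMem he, D.genMap_edge_of_notMem hf]
    calc _ = treeElt F T' (D.onV (Γ.rng e)) (Δ.rng (D.onE ⟨e, he⟩)) * (gh F Δ (D.onE ⟨e, he⟩) *
        (treeElt F T' (Δ.src (D.onE ⟨e, he⟩)) (D.onV (Γ.src e)) *
          treeElt F T' (D.onV (Γ.src f)) (Δ.src (D.onE ⟨f, hf⟩)))) * ed F Δ (D.onE ⟨f, hf⟩) *
          treeElt F T' (Δ.rng (D.onE ⟨f, hf⟩)) (D.onV (Γ.rng f)) := by simp only [mul_assoc]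
      _ = 0 := by rw [h1, gh_mul_vx, mul_assoc (treeElt _ _ _ _), h2]; simp
  · rw [← D.genMap_mul_rng, ← D.genMap_src_mul (.edge f), mul_assoc,
      ← mul_assoc (D.genMap F (.vertex _))]
    have : D.genMap F (.vertex (Gen.ghost e).rng) * D.genMap F (.vertex (Gen.edge f).src) = 0 :=
      vx_mul_of_ne fun h => hs (D.onV.injective h)
    rw [this]; simp

theorem genMap_ghost_mul_edge (e : Γ.E) :
    D.genMap F (.ghost e) * D.genMap F (.edge e) = D.genMap F (.vertex (Γ.rng e)) := by
  by_cases h : e ∈ T.treeEdges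
  · rw [D.genMap_ghost_of_mem h, D.genMap_edge_of_mem h,
      treeElt_mul (D.cls_onV_rng h) (D.cls_onV_rng h).symm, treeElt_self]; rfl
  · rw [D.genMap_ghost_of_notMem h, D.genMap_edge_of_notMem h]
    calc _ = treeElt F T' (D.onV (Γ.rng e)) (Δ.rng (D.onE ⟨e, h⟩)) * (gh F Δ (D.onE ⟨e, h⟩) *
        (treeElt F T' (Δ.src (D.onE ⟨e, h⟩)) (D.onV (Γ.src e)) *
          treeElt F T' (D.onV (Γ.src e)) (Δ.src (D.onE ⟨e, h⟩)))) * ed F Δ (D.onE ⟨e, h⟩) *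
          treeElt F T' (Δ.rng (D.onE ⟨e, h⟩)) (D.onV (Γ.rng e)) := by simp only [mul_assoc]
      _ = vx F Δ (D.onV (Γ.rng e)) := by
        rw [treeElt_mul (D.cls_src ⟨e, h⟩) (D.cls_src ⟨e, h⟩).symm, treeElt_self, gh_mul_vx,
          mul_assoc (treeElt _ _ _ _), gh_mul_ed, treeElt_mul_vx (D.cls_rng ⟨e, h⟩).symm,
          treeElt_mul (D.cls_rng ⟨e, h⟩).symm (D.cls_rng ⟨e, h⟩), treeElt_self]

theorem genMap_edge_mul_ghost_of_notMem {e : Γ.E} (h : e ∉ T.treeEdges) :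
    D.genMap F (.edge e) * D.genMap F (.ghost e) =
      treeElt F T' (D.onV (Γ.src e)) (Δ.src (D.onE ⟨e, h⟩)) *
        (ed F Δ (D.onE ⟨e, h⟩) * gh F Δ (D.onE ⟨e, h⟩)) *
          treeElt F T' (Δ.src (D.onE ⟨e, h⟩)) (D.onV (Γ.src e)) := by
  rw [D.genMap_ghost_of_notMem h, D.genMap_edge_of_notMem h]
  calc _ = treeElt F T' (D.onV (Γ.src e)) (Δ.src (D.onE ⟨e, h⟩)) * (ed F Δ (D.onE ⟨e, h⟩) *
      (treeElt F T' (Δ.rng (D.onE ⟨e, h⟩)) (D.onV (Γ.rng e)) *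
        treeElt F T' (D.onV (Γ.rng e)) (Δ.rng (D.onE ⟨e, h⟩)))) * gh F Δ (D.onE ⟨e, h⟩) *
        treeElt F T' (Δ.src (D.onE ⟨e, h⟩)) (D.onV (Γ.src e)) := by simp only [mul_assoc]
    _ = _ := by
      rw [treeElt_mul (D.cls_rng ⟨e, h⟩) (D.cls_rng ⟨e, h⟩).symm, treeElt_self, ed_mul_vx]
      simp only [mul_assoc]

/-- The Cuntz-Krieger relation at `v`. If `v` emits a tree edge, this is its only edge. Otherwise
all edges from `v` lie outside the trees, and their images are all the edges emitted by a vertex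
`u` equivalent to the image of `v`; the relation is then the one at `u`, carried to the image of
`v` by the tree. -/
theorem genMap_cuntzKrieger (v : Γ.V) (hfin : {e : Γ.E | Γ.src e = v}.Finite)
    (hne : {e : Γ.E | Γ.src e = v}.Nonempty) :
    D.genMap F (.vertex v) =
      ∑ e ∈ hfin.toFinset, D.genMap F (.edge e) * D.genMap F (.ghost e) := by
  classical
  obtain ⟨e₀, rfl⟩ := hne
  by_cases h₀ : e₀ ∈ T.treeEdges
  · have hs : hfin.toFinset = {e₀} := by
      ext f
      simp only [Set.Finite.mem_toFinset, Set.mem_ofPred_eq, Finset.mem_singleton]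
      exact ⟨fun h => IsNE.eq_of_src_eq (NESpanningTrees.treeEdges_subset h₀) h, fun h => by rw [h]⟩
    rw [hs, Finset.sum_singleton, D.genMap_edge_of_mem h₀, D.genMap_ghost_of_mem h₀,
      treeElt_mul (D.cls_onV_rng h₀).symm (D.cls_onV_rng h₀), treeElt_self]
    rfl
  have hnot : ∀ e, Γ.src e = Γ.src e₀ → e ∉ T.treeEdges := fun e he h =>
    h₀ ((IsNE.eq_of_src_eq (NESpanningTrees.treeEdges_subset h) he.symm) ▸ h)
  let g : Γ.E → Δ.E := fun e => if h : e ∉ T.treeEdges then D.onE ⟨e, h⟩ else D.onE ⟨e₀, h₀⟩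
  have hg : ∀ {e} (h : e ∉ T.treeEdges), g e = D.onE ⟨e, h⟩ := fun h => dif_pos h
  set u : Δ.V := Δ.src (D.onE ⟨e₀, h₀⟩) with hu
  have himage : {e' : Δ.E | Δ.src e' = u} = g '' {e : Γ.E | Γ.src e = Γ.src e₀} := by
    ext e'
    constructor
    · intro (he' : Δ.src e' = u)
      have h' : e' ∉ T'.treeEdges := fun h => (D.onE ⟨e₀, h₀⟩).2
        (IsNE.eq_of_src_eq (NESpanningTrees.treeEdges_subset h) he'.symm ▸ h)
      refine ⟨(D.onE.symm ⟨e', h'⟩).1, ?_, ?_⟩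
      · refine NESpanningTrees.src_eq_src (D.onE.symm ⟨e', h'⟩).2 h₀ ?_
        rw [← D.cls_iff, ← D.cls_src, ← D.cls_src ⟨e₀, h₀⟩]
        simp [he', hu]
      · rw [hg (D.onE.symm ⟨e', h'⟩).2]; simp
    · rintro ⟨e, he, rfl⟩
      change Δ.src (g e) = u
      rw [hg (hnot e he)]
      exact D.src_onE_eq _ h₀ he
  have hinj : Set.InjOn g {e : Γ.E | Γ.src e = Γ.src e₀} := by
    intro e he f hf h
    rw [hg (hnot e he), hg (hnot f hf)] at h
    simpa using D.onE.injective (Subtype.ext h)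
  have hfin' : {e' : Δ.E | Δ.src e' = u}.Finite := himage ▸ hfin.image g
  have hto : hfin'.toFinset = hfin.toFinset.image g := by
    ext e'
    simpa using Set.ext_iff.1 himage e'
  have hCK : vx F Δ u = _ :=
    (isLeavittFamily_gen (F := F) (Γ := Δ)).cuntzKrieger u hfin' ⟨_, hu.symm⟩
  rw [hto, Finset.sum_image (by simpa using hinj)] at hCK
  calc D.genMap F (.vertex (Γ.src e₀))
      = treeElt F T' (D.onV (Γ.src e₀)) u * vx F Δ u * treeElt F T' u (D.onV (Γ.src e₀)) := by
        have hcls : Δ.cls (D.onV (Γ.src e₀)) = Δ.cls u := (D.cls_src ⟨e₀, h₀⟩).symm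
        rw [treeElt_mul_vx hcls, treeElt_mul hcls hcls.symm, treeElt_self]
        rfl
    _ = _ := by
        rw [hCK, Finset.mul_sum, Finset.sum_mul]
        refine Finset.sum_congr rfl fun e he => ?_
        have he : Γ.src e = Γ.src e₀ := by simpa using he
        rw [D.genMap_edge_mul_ghost_of_notMem (hnot e he), hg (hnot e he),
          D.src_onE_eq (hnot e he) h₀ he, he]

theorem isLeavittFamily_genMap : Γ.IsLeavittFamily (D.genMap F) where
  src_mul := D.genMap_src_mul
  mul_rng := D.genMap_mul_rng
  vertex_mul _ _ h := vx_mul_of_ne fun h' => h (D.onV.injective h')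
  ghost_mul_edge_of_ne _ _ := D.genMap_ghost_mul_edge_of_ne
  ghost_mul_edge := D.genMap_ghost_mul_edge
  cuntzKrieger := D.genMap_cuntzKrieger

variable (F) in
/-- The ring homomorphism between the Leavitt path algebras given by a contraction equivalence. -/
noncomputable def lift : LeavittPathAlgebra F Γ →ₙ+* LeavittPathAlgebra F Δ :=
  (D.isLeavittFamily_genMap (F := F)).exists_lift.choose

theorem lift_gen (x : Γ.Gen) : D.lift F (gen F Γ x) = D.genMap F x :=
  (D.isLeavittFamily_genMap (F := F)).exists_lift.choose_spec x

theorem lift_pe_ps {v w : Γ.V} {p : List Γ.E} (hp : Γ.IsPathIn T.treeEdges v p w) :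
    D.lift F (pe F Γ v p) = treeElt F T' (D.onV v) (D.onV w) ∧
      D.lift F (ps F Γ v p) = treeElt F T' (D.onV w) (D.onV v) := by
  induction p generalizing v with
  | nil =>
    obtain rfl := isPathIn_nil_iff.1 hp
    rw [pe_nil, ps_nil, D.lift_gen, treeElt_self]
    exact ⟨rfl, rfl⟩
  | cons e p ih =>
    obtain ⟨rfl, he, hp₂⟩ := isPathIn_cons_iff.1 hp
    have h1 := (D.cls_iff _ _).2 (hp₂.cls_eq NESpanningTrees.treeEdges_subset)
    have h2 := D.cls_onV_rng he
    rw [pe_cons, ps_cons, map_mul, map_mul, (ih hp₂).1, (ih hp₂).2, D.lift_gen, D.lift_gen,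
      D.genMap_edge_of_mem he, D.genMap_ghost_of_mem he]
    exact ⟨treeElt_mul h2.symm h1, treeElt_mul h1.symm h2⟩

theorem lift_treeElt {v w : Γ.V} (h : Γ.cls v = Γ.cls w) :
    D.lift F (treeElt F T v w) = treeElt F T' (D.onV v) (D.onV w) := by
  obtain ⟨p, q, x, hp, hq⟩ := T.confluent h
  have h1 := (D.cls_iff _ _).2 (hp.cls_eq NESpanningTrees.treeEdges_subset)
  have h2 := (D.cls_iff _ _).2 (hq.cls_eq NESpanningTrees.treeEdges_subset)
  rw [treeElt_eq hp hq, map_mul, (D.lift_pe_ps hp).1, (D.lift_pe_ps hq).2, treeElt_mul h1 h2.symm]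

theorem symm_lift_lift_gen (x : Γ.Gen) : D.symm.lift F (D.lift F (gen F Γ x)) = gen F Γ x := by
  have hV : ∀ v, D.symm.onV (D.onV v) = v := D.onV.symm_apply_apply
  have hE : ∀ {e} (h : e ∉ T.treeEdges), D.symm.onE (D.onE ⟨e, h⟩) = ⟨e, h⟩ := fun h =>
    D.onE.symm_apply_apply _
  rcases x with v | e | e
  · rw [D.lift_gen, genMap, lift_gen, genMap, hV]
  · by_cases h : e ∈ T.treeEdges
    · rw [D.lift_gen, D.genMap_edge_of_mem h, lift_treeElt _ (D.cls_onV_rng h).symm, hV, hV,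
        treeElt_edge h]
    · have hs := D.cls_src ⟨e, h⟩
      have hr := D.cls_rng ⟨e, h⟩
      have hs' := (D.symm.cls_iff _ _).2 hs
      have hr' := (D.symm.cls_iff _ _).2 hr
      rw [hV] at hs' hr'
      rw [D.lift_gen, D.genMap_edge_of_notMem h, map_mul, map_mul, lift_treeElt _ hs.symm,
        lift_treeElt _ hr, lift_gen, D.symm.genMap_edge_of_notMem (D.onE ⟨e, h⟩).2, hV, hV,
        ← mul_assoc, ← mul_assoc, mul_assoc _ (treeElt _ _ _ _) (treeElt _ _ _ _)]
      simp only [Subtype.coe_eta, hE]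
      rw [treeElt_mul hs'.symm hs', treeElt_mul hr'.symm hr', treeElt_self, treeElt_self,
        vx_mul_ed, ed_mul_vx]
  · by_cases h : e ∈ T.treeEdges
    · rw [D.lift_gen, D.genMap_ghost_of_mem h, lift_treeElt _ (D.cls_onV_rng h), hV, hV,
        treeElt_ghost h]
    · have hs := D.cls_src ⟨e, h⟩
      have hr := D.cls_rng ⟨e, h⟩
      have hs' := (D.symm.cls_iff _ _).2 hs
      have hr' := (D.symm.cls_iff _ _).2 hr
      rw [hV] at hs' hr'
      rw [D.lift_gen, D.genMap_ghost_of_notMem h, map_mul, map_mul, lift_treeElt _ hs,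
        lift_treeElt _ hr.symm, lift_gen, D.symm.genMap_ghost_of_notMem (D.onE ⟨e, h⟩).2, hV, hV,
        ← mul_assoc, ← mul_assoc, mul_assoc _ (treeElt _ _ _ _) (treeElt _ _ _ _)]
      simp only [Subtype.coe_eta, hE]
      rw [treeElt_mul hs'.symm hs', treeElt_mul hr'.symm hr', treeElt_self, treeElt_self,
        vx_mul_gh, gh_mul_vx]

theorem genMap_mem (x : Γ.Gen) : D.genMap F x ∈ LeavittInverseSemigroup F Δ := by
  rcases x with v | e | e
  · exact gen_mem _
  · by_cases h : e ∈ T.treeEdges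
    · rw [D.genMap_edge_of_mem h]; exact treeElt_mem (D.cls_onV_rng h).symm
    · rw [D.genMap_edge_of_notMem h]
      exact mul_mem (mul_mem (treeElt_mem (D.cls_src ⟨e, h⟩).symm) (gen_mem _))
        (treeElt_mem (D.cls_rng ⟨e, h⟩))
  · by_cases h : e ∈ T.treeEdges
    · rw [D.genMap_ghost_of_mem h]; exact treeElt_mem (D.cls_onV_rng h)
    · rw [D.genMap_ghost_of_notMem h]
      exact mul_mem (mul_mem (treeElt_mem (D.cls_rng ⟨e, h⟩).symm) (gen_mem _))
        (treeElt_mem (D.cls_src ⟨e, h⟩))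

theorem lift_mem {x : LeavittPathAlgebra F Γ} (hx : x ∈ LeavittInverseSemigroup F Γ) :
    D.lift F x ∈ LeavittInverseSemigroup F Δ := by
  induction hx using Subsemigroup.closure_induction with
  | mem x hx =>
    rcases hx with rfl | ⟨x, rfl⟩
    · rw [map_zero]; exact zero_mem
    · rw [D.lift_gen]; exact D.genMap_mem x
  | mul x y _ _ ihx ihy => rw [map_mul]; exact mul_mem ihx ihy

theorem symm_lift_lift {x : LeavittPathAlgebra F Γ} (hx : x ∈ LeavittInverseSemigroup F Γ) :
    D.symm.lift F (D.lift F x) = x := by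
  induction hx using Subsemigroup.closure_induction with
  | mem x hx =>
    rcases hx with rfl | ⟨x, rfl⟩
    · simp
    · exact D.symm_lift_lift_gen x
  | mul x y _ _ ihx ihy => rw [map_mul, map_mul, ihx, ihy]

variable (F) in
/-- A contraction equivalence induces an isomorphism of Leavitt inverse semigroups. -/
noncomputable def mulEquiv :
    LeavittInverseSemigroup F Γ ≃* LeavittInverseSemigroup F Δ where
  toFun x := ⟨D.lift F x, D.lift_mem x.2⟩
  invFun x := ⟨D.symm.lift F x, D.symm.lift_mem x.2⟩
  left_inv x := Subtype.ext (D.symm_lift_lift x.2)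
  right_inv x := Subtype.ext (D.symm.symm_lift_lift x.2)
  map_mul' x y := Subtype.ext (map_mul (D.lift F) x.1 y.1)

end ContractionEquiv

/-! ### A representation separating the elements of the Leavitt inverse semigroup -/

section Representation

variable (Γ : DirGraph)

/-- For every vertex that emits edges, a set of the cardinality of `ℕ ⊕ Γ.E` is the disjoint
union of copies of itself indexed by the edges from the vertex. -/
theorem exists_branching : ∃ β : Γ.E → (ℕ ⊕ Γ.E) → (ℕ ⊕ Γ.E),
    (∀ e f k l, Γ.src e = Γ.src f → β e k = β f l → e = f ∧ k = l) ∧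
      ∀ f k, ∃ e l, Γ.src e = Γ.src f ∧ β e l = k := by
  have key : ∀ v : Γ.V, Nonempty {e : Γ.E // Γ.src e = v} →
      Nonempty ({e : Γ.E // Γ.src e = v} × (ℕ ⊕ Γ.E) ≃ (ℕ ⊕ Γ.E)) := by
    intro v hv
    have h : Cardinal.mk {e : Γ.E // Γ.src e = v} ≤ Cardinal.mk (ℕ ⊕ Γ.E) :=
      Cardinal.mk_le_of_injective (f := fun e => Sum.inr e.1)
        (Sum.inr_injective.comp Subtype.val_injective)
    have := Cardinal.mul_eq_right (Cardinal.aleph0_le_mk (ℕ ⊕ Γ.E)) h (Cardinal.mk_ne_zero _)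
    rw [Cardinal.mul_def] at this
    exact Cardinal.eq.1 this
  have hne : ∀ e : Γ.E, Nonempty {f : Γ.E // Γ.src f = Γ.src e} := fun e => ⟨⟨e, rfl⟩⟩
  let β : Γ.E → (ℕ ⊕ Γ.E) → (ℕ ⊕ Γ.E) := fun e k => (key (Γ.src e) (hne e)).some (⟨e, rfl⟩, k)
  have hβ : ∀ e f (h : Γ.src e = Γ.src f) k,
      β e k = (key (Γ.src f) (hne f)).some (⟨e, h⟩, k) := by
    intro e f
    generalize hne f = hf
    generalize Γ.src f = v at hf
    rintro rfl k
    rfl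
  refine ⟨β, fun e f k l h hkl => ?_, fun f k => ?_⟩
  · rw [hβ e f h, hβ f f rfl] at hkl
    simpa using (key (Γ.src f) (hne f)).some.injective hkl
  · obtain ⟨⟨⟨e, he⟩, l⟩, hel⟩ := (key (Γ.src f) (hne f)).some.surjective k
    exact ⟨e, l, he, by rw [hβ e f he]; exact hel⟩

/-- The maps identifying a set with copies of itself, see `exists_branching`. -/
noncomputable def branch : Γ.E → (ℕ ⊕ Γ.E) → (ℕ ⊕ Γ.E) := Γ.exists_branching.choose

/-- The set on which the Leavitt inverse semigroup acts by partial bijections. The first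
component is the vertex over which a point lies; the last one records lengths of paths, so that
a closed path never acts as the identity. -/
abbrev Point : Type _ := Γ.V × (ℕ ⊕ Γ.E) × ℤ

variable {Γ}

/-- The action of an edge `e`, meant for points over the range of `e`. -/
noncomputable def push (e : Γ.E) (x : Γ.Point) : Γ.Point :=
  (Γ.src e, Γ.branch e x.2.1, x.2.2 + 1)

theorem push_inj {e f : Γ.E} {x y : Γ.Point} (hx : x.1 = Γ.rng e) (hy : y.1 = Γ.rng f)
    (h : push e x = push f y) : e = f ∧ x = y := by
  obtain ⟨h1, h2, h3⟩ : Γ.src e = Γ.src f ∧ Γ.branch e x.2.1 = Γ.branch f y.2.1 ∧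
      x.2.2 + 1 = y.2.2 + 1 := by simpa [push] using h
  obtain ⟨rfl, h4⟩ := Γ.exists_branching.choose_spec.1 _ _ _ _ h1 h2
  exact ⟨rfl, Prod.ext (hx.trans hy.symm) (Prod.ext h4 (add_right_cancel h3))⟩

theorem exists_push_eq (f : Γ.E) (y : Γ.Point) (hy : y.1 = Γ.src f) :
    ∃ e x, Γ.src e = Γ.src f ∧ x.1 = Γ.rng e ∧ y = push e x := by
  obtain ⟨e, l, he, hl⟩ := Γ.exists_branching.choose_spec.2 f y.2.1
  refine ⟨e, (Γ.rng e, l, y.2.2 - 1), he, rfl, Prod.ext (hy.trans he.symm) (Prod.ext hl.symm ?_)⟩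
  simp [push]

open Classical in
/-- The action of an edge as a partial bijection, mapping `push e x` to `x`. -/
noncomputable def edgePEquiv (e : Γ.E) : Γ.Point ≃. Γ.Point where
  toFun y := if h : ∃ x, x.1 = Γ.rng e ∧ y = push e x then some h.choose else none
  invFun x := if x.1 = Γ.rng e then some (push e x) else none
  inv y x := by
    by_cases hx : x.1 = Γ.rng e
    · by_cases h : ∃ x, x.1 = Γ.rng e ∧ y = push e x
      · rw [if_pos hx, dif_pos h]
        obtain ⟨h1, h2⟩ := h.choose_spec
        simp only [Option.some.injEq]
        refine ⟨fun h' => ?_, fun h' => ?_⟩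
        · exact (push_inj hx h1 (h'.trans h2)).2.symm
        · rw [← h']; exact h2.symm
      · rw [if_pos hx, dif_neg h]
        simp only [Option.some.injEq, reduceCtorEq, iff_false]
        exact fun h' => h ⟨x, hx, h'.symm⟩
    · rw [if_neg hx]
      simp only [reduceCtorEq, false_iff]
      intro h'
      split_ifs at h' with h
      exact hx (Option.some.inj h' ▸ h.choose_spec.1)

open Classical in
theorem mem_edgePEquiv {e : Γ.E} {x y : Γ.Point} :
    x ∈ edgePEquiv e y ↔ x.1 = Γ.rng e ∧ y = push e x := by
  rw [← PEquiv.mem_iff_mem]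
  change y ∈ (if x.1 = Γ.rng e then some (push e x) else none) ↔ _
  split_ifs with h <;> simp [h, eq_comm]

open Classical in
/-- The partial identity on the points over the vertex `v`. -/
noncomputable def vertexPEquiv (v : Γ.V) : Γ.Point ≃. Γ.Point :=
  PEquiv.ofSet {x | x.1 = v}

open Classical in
theorem mem_vertexPEquiv {v : Γ.V} {x y : Γ.Point} :
    x ∈ vertexPEquiv v y ↔ x.1 = v ∧ y = x := by
  rw [vertexPEquiv, PEquiv.mem_ofSet_iff]
  constructor
  · rintro ⟨rfl, h⟩; exact ⟨h, rfl⟩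
  · rintro ⟨h, rfl⟩; exact ⟨rfl, h⟩

section PullBack

variable (F : Type*) [Field F] {X : Type*}

/-- The linear operator on functions given by composition with a partial map, extended
by zero. -/
def pullBack (π : X ≃. X) : Module.End F (X → F) where
  toFun g y := (π y).elim 0 g
  map_add' g h := by ext y; rcases hy : π y with - | x <;> simp [hy]
  map_smul' c g := by ext y; rcases hy : π y with - | x <;> simp [hy]

variable {F}

theorem pullBack_apply (π : X ≃. X) (g : X → F) (y : X) :
    pullBack F π g y = (π y).elim 0 g := rfl

theorem pullBack_mul (π π' : X ≃. X) :
    pullBack F π * pullBack F π' = pullBack F (π.trans π') := by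
  ext g y
  change (π y).elim 0 (fun z => (π' z).elim 0 g) = ((π y).bind π').elim 0 g
  rcases π y with - | x <;> rfl

theorem pullBack_bot : pullBack F (⊥ : X ≃. X) = 0 := rfl

theorem pullBack_injective : Function.Injective (pullBack F : (X ≃. X) → _) := by
  classical
  intro π π' h
  have key : ∀ (π : X ≃. X) y x, x ∈ π y ↔ pullBack F π (Pi.single x 1) y = 1 := by
    intro π y x
    rw [pullBack_apply]
    rcases π y with - | z
    · simp
    · by_cases hz : z = x
      · simp [hz]
      · simp [hz]
  refine PEquiv.ext fun y => Option.ext fun x => ?_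
  have h1 := key π y x
  rw [h, ← key π' y x] at h1
  exact h1

end PullBack

variable (F : Type*) [Field F]

/-- The operators by which the generators of the Leavitt path algebra act. -/
noncomputable def repGen : Γ.Gen → Module.End F (Γ.Point → F)
  | .vertex v => pullBack F (vertexPEquiv v)
  | .edge e => pullBack F (edgePEquiv e)
  | .ghost e => pullBack F (edgePEquiv e).symm

variable {F}

theorem pequiv_ext_mem {X : Type*} {π π' : X ≃. X} (h : ∀ x y, x ∈ π y ↔ x ∈ π' y) : π = π' :=
  PEquiv.ext fun y => Option.ext fun x => h x y

theorem repGen_vertex_mul_vertex (v : Γ.V) :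
    repGen F (.vertex v) * repGen F (.vertex v) = repGen F (.vertex v : Γ.Gen) := by
  rw [repGen, pullBack_mul]
  congr 1
  refine pequiv_ext_mem fun x y => ?_
  simp only [PEquiv.mem_trans, mem_vertexPEquiv]
  constructor
  · rintro ⟨z, ⟨_, rfl⟩, h⟩; exact h
  · rintro ⟨h, rfl⟩; exact ⟨y, ⟨h, rfl⟩, h, rfl⟩

theorem vertex_trans_edge (e : Γ.E) :
    (vertexPEquiv (Γ.src e)).trans (edgePEquiv e) = edgePEquiv e := by
  refine pequiv_ext_mem fun x y => ?_
  simp only [PEquiv.mem_trans, mem_vertexPEquiv, mem_edgePEquiv]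
  constructor
  · rintro ⟨z, ⟨_, rfl⟩, h⟩; exact h
  · rintro ⟨h, rfl⟩; exact ⟨_, ⟨rfl, rfl⟩, h, rfl⟩

theorem edge_trans_vertex (e : Γ.E) :
    (edgePEquiv e).trans (vertexPEquiv (Γ.rng e)) = edgePEquiv e := by
  refine pequiv_ext_mem fun x y => ?_
  simp only [PEquiv.mem_trans, mem_vertexPEquiv, mem_edgePEquiv]
  constructor
  · rintro ⟨z, h, _, rfl⟩; exact h
  · rintro ⟨h, rfl⟩; exact ⟨_, ⟨h, rfl⟩, h, rfl⟩

open Classical in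
theorem vertexPEquiv_symm (v : Γ.V) : (vertexPEquiv v).symm = vertexPEquiv v :=
  PEquiv.ofSet_symm _

theorem isLeavittFamily_repGen : Γ.IsLeavittFamily (repGen F) where
  src_mul := by
    rintro (v | e | e)
    · exact repGen_vertex_mul_vertex v
    · exact (pullBack_mul _ _).trans (congrArg _ (vertex_trans_edge e))
    · refine (pullBack_mul _ _).trans (congrArg _ ?_)
      have := congrArg PEquiv.symm (edge_trans_vertex e)
      rwa [PEquiv.symm_trans_rev, vertexPEquiv_symm] at this
  mul_rng := by
    rintro (v | e | e)
    · exact repGen_vertex_mul_vertex v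
    · exact (pullBack_mul _ _).trans (congrArg _ (edge_trans_vertex e))
    · refine (pullBack_mul _ _).trans (congrArg _ ?_)
      have := congrArg PEquiv.symm (vertex_trans_edge e)
      rwa [PEquiv.symm_trans_rev, vertexPEquiv_symm] at this
  vertex_mul u v h := by
    refine (pullBack_mul _ _).trans ((congrArg _ ?_).trans pullBack_bot)
    refine pequiv_ext_mem fun x y => ?_
    simp only [PEquiv.mem_trans, mem_vertexPEquiv, PEquiv.bot_apply, Option.not_mem_none, iff_false]
    rintro ⟨z, ⟨h1, -⟩, h2, rfl⟩
    exact h (h1.symm.trans h2)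
  ghost_mul_edge_of_ne e f h := by
    refine (pullBack_mul _ _).trans ((congrArg _ ?_).trans pullBack_bot)
    refine pequiv_ext_mem fun x y => ?_
    simp only [PEquiv.mem_trans, PEquiv.mem_iff_mem, mem_edgePEquiv, PEquiv.bot_apply,
      Option.not_mem_none, iff_false]
    rintro ⟨z, ⟨h1, h2⟩, h3, h4⟩
    exact h (push_inj h1 h3 (h2.symm.trans h4)).1
  ghost_mul_edge e := by
    refine (pullBack_mul _ _).trans (congrArg _ ?_)
    refine pequiv_ext_mem fun x y => ?_
    simp only [PEquiv.mem_trans, PEquiv.mem_iff_mem, mem_edgePEquiv, mem_vertexPEquiv]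
    constructor
    · rintro ⟨z, ⟨h1, h2⟩, h3, h4⟩
      exact ⟨h3, (push_inj h1 h3 (h2.symm.trans h4)).2⟩
    · rintro ⟨h, rfl⟩
      exact ⟨_, ⟨h, rfl⟩, h, rfl⟩
  cuntzKrieger v hfin hne := by
    classical
    obtain ⟨f, rfl⟩ := hne
    have hpt : ∀ (e : Γ.E) (g : Γ.Point → F) (y : Γ.Point),
        (repGen F (.edge e) * repGen F (.ghost e)) g y =
          if ∃ x, x.1 = Γ.rng e ∧ y = push e x then g y else 0 := by
      intro e g y
      change pullBack F (edgePEquiv e) (pullBack F (edgePEquiv e).symm g) y = _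
      rw [pullBack_apply]
      rcases hy : edgePEquiv e y with - | z
      · rw [if_neg]
        · rfl
        · rintro ⟨x, hx⟩
          have := mem_edgePEquiv.2 hx
          simp [hy] at this
      · have hz := mem_edgePEquiv.1 (Option.mem_def.2 hy)
        rw [if_pos ⟨z, hz⟩, Option.elim_some, pullBack_apply,
          (PEquiv.eq_some_iff _).2 hy, Option.elim_some]
    ext g y
    rw [LinearMap.sum_apply, Finset.sum_apply]
    simp only [hpt]
    change (vertexPEquiv (Γ.src f) y).elim 0 g = _
    by_cases hy : y.1 = Γ.src f
    · rw [Option.mem_def.1 (mem_vertexPEquiv.2 ⟨hy, rfl⟩), Option.elim_some]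
      obtain ⟨e, x, he, hx, hyx⟩ := exists_push_eq f y hy
      rw [Finset.sum_eq_single e, if_pos ⟨x, hx, hyx⟩]
      · intro e' _ hne
        rw [if_neg]
        rintro ⟨x', hx', hyx'⟩
        exact hne (push_inj hx' hx (hyx'.symm.trans hyx)).1
      · intro hnot
        exact absurd (hfin.mem_toFinset.2 he) hnot
    · rw [Finset.sum_eq_zero]
      · rcases hv : vertexPEquiv (Γ.src f) y with - | z
        · rfl
        · obtain ⟨h1, h2⟩ := mem_vertexPEquiv.1 (Option.mem_def.2 hv)
          exact absurd (h2 ▸ h1) hy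
      · intro e he
        rw [if_neg]
        rintro ⟨x, -, rfl⟩
        exact hy (hfin.mem_toFinset.1 he)

variable (Γ F) in
/-- The representation of the Leavitt path algebra on the functions on the set of points. -/
noncomputable def rep : LeavittPathAlgebra F Γ →ₙ+* Module.End F (Γ.Point → F) :=
  (isLeavittFamily_repGen (F := F) (Γ := Γ)).exists_lift.choose

theorem rep_gen (x : Γ.Gen) : rep Γ F (LeavittPathAlgebra.gen F Γ x) = repGen F x :=
  (isLeavittFamily_repGen (F := F) (Γ := Γ)).exists_lift.choose_spec x

/-- The action of a path. -/
noncomputable def pushPath (p : List Γ.E) (x : Γ.Point) : Γ.Point := p.foldr push x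

theorem pushPath_nil (x : Γ.Point) : pushPath [] x = x := rfl

theorem pushPath_cons (e : Γ.E) (p : List Γ.E) (x : Γ.Point) :
    pushPath (e :: p) x = push e (pushPath p x) := rfl

theorem pushPath_fst {v w : Γ.V} {p : List Γ.E} (hp : Γ.IsPath v p w) {x : Γ.Point}
    (hx : x.1 = w) : (pushPath p x).1 = v := by
  cases hp with
  | nil v => exact hx
  | cons e _ => rfl

theorem pushPath_length (p : List Γ.E) (x : Γ.Point) :
    (pushPath p x).2.2 = x.2.2 + p.length := by
  induction p with
  | nil => simp [pushPath_nil]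
  | cons e p ih => rw [pushPath_cons, push, ih, List.length_cons]; push_cast; ring

/-- Paths whose actions have a common value are comparable for the prefix order. -/
theorem prefix_or_prefix_of_pushPath_eq {v w v' w' : Γ.V} {p q : List Γ.E} {x y : Γ.Point}
    (hp : Γ.IsPath v p w) (hq : Γ.IsPath v' q w') (hx : x.1 = w) (hy : y.1 = w')
    (h : pushPath p x = pushPath q y) :
    (∃ t, q = p ++ t ∧ Γ.IsPath w t w' ∧ x = pushPath t y) ∨
      ∃ t, p = q ++ t ∧ Γ.IsPath w' t w ∧ y = pushPath t x := by
  induction p generalizing v v' q with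
  | nil =>
    obtain rfl := isPath_nil_iff.1 hp
    refine Or.inl ⟨q, rfl, ?_, h⟩
    obtain rfl : v = v' := hx.symm.trans ((congrArg Prod.fst h).trans (pushPath_fst hq hy))
    exact hq
  | cons e p ih =>
    cases q with
    | nil =>
      obtain rfl := isPath_nil_iff.1 hq
      refine Or.inr ⟨e :: p, rfl, ?_, h.symm⟩
      obtain rfl : v' = v := hy.symm.trans ((congrArg Prod.fst h).symm.trans (pushPath_fst hp hx))
      exact hp
    | cons f q =>
      obtain ⟨-, hp₂⟩ := isPath_cons_iff.1 hp
      obtain ⟨-, hq₂⟩ := isPath_cons_iff.1 hq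
      rw [pushPath_cons, pushPath_cons] at h
      obtain ⟨rfl, h'⟩ := push_inj (pushPath_fst hp₂ hx) (pushPath_fst hq₂ hy) h
      rcases ih hp₂ hq₂ h' with ⟨t, rfl, ht⟩ | ⟨t, rfl, ht⟩
      · exact Or.inl ⟨t, rfl, ht⟩
      · exact Or.inr ⟨t, rfl, ht⟩

/-- A path whose action reaches every point over its source is an NE path: an edge `f` with the
source of an edge `e` of the path, but distinct from `e`, would yield points out of reach. -/
theorem isNEPath_of_forall_exists_pushPath {v w : Γ.V} {t : List Γ.E} (ht : Γ.IsPath v t w)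
    (h : ∀ x : Γ.Point, x.1 = v → ∃ y : Γ.Point, y.1 = w ∧ x = pushPath t y) :
    Γ.IsNEPath v t w := by
  refine ⟨ht, fun e he => isNE_iff.2 fun f hf => ?_⟩
  obtain ⟨t₁, t₂, rfl⟩ := List.append_of_mem he
  obtain ⟨u, ht₁, hu⟩ := isPath_append_iff.1 ht
  have hf' : Γ.IsPath u [f] (Γ.rng f) :=
    isPath_cons_iff.2 ⟨hf.trans (isPath_cons_iff.1 hu).1, .nil _⟩
  have hpath := ht₁.append hf'
  let x : Γ.Point := (Γ.rng f, Sum.inl 0, 0)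
  obtain ⟨y, hy, hxy⟩ := h (pushPath (t₁ ++ [f]) x) (pushPath_fst hpath rfl)
  rcases prefix_or_prefix_of_pushPath_eq hpath ht rfl hy hxy with ⟨s, hs, -⟩ | ⟨s, hs, -⟩
  · rw [List.append_assoc, List.append_cancel_left_eq] at hs
    exact ((List.cons_eq_cons.1 hs).1).symm
  · rw [List.append_assoc, List.append_cancel_left_eq] at hs
    exact (List.cons_eq_cons.1 hs).1

open LeavittPathAlgebra

/-- The partial bijection by which a path acts. -/
noncomputable def pathPEquiv : Γ.V → List Γ.E → (Γ.Point ≃. Γ.Point)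
  | v, [] => vertexPEquiv v
  | _, e :: p => (edgePEquiv e).trans (pathPEquiv (Γ.rng e) p)

theorem mem_pathPEquiv {v w : Γ.V} {p : List Γ.E} (hp : Γ.IsPath v p w) {x y : Γ.Point} :
    x ∈ pathPEquiv v p y ↔ x.1 = w ∧ y = pushPath p x := by
  induction hp generalizing y with
  | nil v => exact mem_vertexPEquiv
  | cons e hp ih =>
    simp only [pathPEquiv, PEquiv.mem_trans, mem_edgePEquiv, ih, pushPath_cons]
    constructor
    · rintro ⟨z, ⟨h1, rfl⟩, h2, rfl⟩; exact ⟨h2, rfl⟩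
    · rintro ⟨h1, rfl⟩; exact ⟨_, ⟨pushPath_fst hp h1, rfl⟩, h1, rfl⟩

theorem rep_pe_ps (v : Γ.V) (p : List Γ.E) :
    rep Γ F (pe F Γ v p) = pullBack F (pathPEquiv v p) ∧
      rep Γ F (ps F Γ v p) = pullBack F (pathPEquiv v p).symm := by
  induction p generalizing v with
  | nil =>
    rw [pe_nil, ps_nil, rep_gen, pathPEquiv, vertexPEquiv_symm]
    exact ⟨rfl, rfl⟩
  | cons e p ih =>
    rw [pe_cons, ps_cons, map_mul, map_mul, (ih _).1, (ih _).2, rep_gen, rep_gen, pathPEquiv,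
      PEquiv.symm_trans_rev, ← pullBack_mul, ← pullBack_mul]
    exact ⟨rfl, rfl⟩

theorem rep_pe_mul_ps (v u : Γ.V) (p q : List Γ.E) :
    rep Γ F (pe F Γ v p * ps F Γ u q) =
      pullBack F ((pathPEquiv v p).trans (pathPEquiv u q).symm) := by
  rw [map_mul, (rep_pe_ps v p).1, (rep_pe_ps u q).2, pullBack_mul]

theorem mem_trans_symm {v u w : Γ.V} {p q : List Γ.E} (hp : Γ.IsPath v p w)
    (hq : Γ.IsPath u q w) {z y : Γ.Point} :
    z ∈ (pathPEquiv v p).trans (pathPEquiv u q).symm y ↔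
      ∃ x : Γ.Point, x.1 = w ∧ y = pushPath p x ∧ z = pushPath q x := by
  simp only [PEquiv.mem_trans, PEquiv.mem_iff_mem, mem_pathPEquiv hp, mem_pathPEquiv hq]
  constructor
  · rintro ⟨x, ⟨h1, h2⟩, -, h3⟩; exact ⟨x, h1, h2, h3⟩
  · rintro ⟨x, h1, h2, h3⟩; exact ⟨x, ⟨h1, h2⟩, h1, h3⟩

theorem pe_mul_ps_ne_zero {v u w : Γ.V} {p q : List Γ.E} (hp : Γ.IsPath v p w)
    (hq : Γ.IsPath u q w) : pe F Γ v p * ps F Γ u q ≠ 0 := by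
  intro h
  have h1 := congrArg (rep Γ F) h
  rw [rep_pe_mul_ps, map_zero, ← pullBack_bot] at h1
  let x : Γ.Point := (w, Sum.inl 0, 0)
  have h2 := (mem_trans_symm hp hq).2 ⟨x, rfl, rfl, rfl⟩
  rw [pullBack_injective h1] at h2
  simp at h2

/-- The elements `p q*` and `p' q'*` agree only if one of the pairs `(p, q)` and `(p', q')` arises
from the other one by appending an NE path. -/
theorem exists_isNEPath_of_pe_mul_ps_eq {v u w v' u' w' : Γ.V} {p q p' q' : List Γ.E}
    (hp : Γ.IsPath v p w) (hq : Γ.IsPath u q w) (hp' : Γ.IsPath v' p' w')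
    (hq' : Γ.IsPath u' q' w') (h : pe F Γ v p * ps F Γ u q = pe F Γ v' p' * ps F Γ u' q') :
    (∃ t, p' = p ++ t ∧ q' = q ++ t ∧ Γ.IsNEPath w t w') ∨
      ∃ t, p = p' ++ t ∧ q = q' ++ t ∧ Γ.IsNEPath w' t w := by
  have h1 := congrArg (rep Γ F) h
  rw [rep_pe_mul_ps, rep_pe_mul_ps] at h1
  have h2 := pullBack_injective h1
  have h3 : ∀ y z, (∃ x : Γ.Point, x.1 = w ∧ y = pushPath p x ∧ z = pushPath q x) ↔
      ∃ x : Γ.Point, x.1 = w' ∧ y = pushPath p' x ∧ z = pushPath q' x := fun y z => by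
    rw [← mem_trans_symm hp hq, ← mem_trans_symm hp' hq', h2]
  clear h h1 h2
  wlog hlen : p.length ≤ p'.length generalizing v u w v' u' w' p q p' q'
  · exact (this hp' hq' hp hq (fun y z => (h3 y z).symm) (by lia)).symm
  left
  have key : ∀ x : Γ.Point, x.1 = w → ∃ (y : Γ.Point) (t : List Γ.E), y.1 = w' ∧
      p' = p ++ t ∧ q' = q ++ t ∧ x = pushPath t y ∧ Γ.IsPath w t w' := by
    intro x hx
    obtain ⟨y, hy, hpe, hqe⟩ := (h3 _ _).1 ⟨x, hx, rfl, rfl⟩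
    have hl1 := congrArg (fun x : Γ.Point => x.2.2) hpe
    have hl2 := congrArg (fun x : Γ.Point => x.2.2) hqe
    simp only [pushPath_length] at hl1 hl2
    obtain ⟨t, hpt, ht, hxt⟩ : ∃ t, p' = p ++ t ∧ Γ.IsPath w t w' ∧ x = pushPath t y := by
      rcases prefix_or_prefix_of_pushPath_eq hp hp' hx hy hpe with h | ⟨t, rfl, ht, hyx⟩
      · exact h
      · obtain rfl : t = [] := by simpa using hlen
        refine ⟨[], by simp, ?_, hyx.symm⟩
        exact isPath_nil_iff.2 (isPath_nil_iff.1 ht).symm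
    obtain ⟨s, hqs, hxs⟩ : ∃ t, q' = q ++ t ∧ x = pushPath t y := by
      rcases prefix_or_prefix_of_pushPath_eq hq hq' hx hy hqe with
        ⟨s, h, -, h'⟩ | ⟨s, rfl, hs, hyx⟩
      · exact ⟨s, h, h'⟩
      · obtain rfl : s = [] := List.length_eq_zero_iff.1 (by simp at hl2; lia)
        exact ⟨[], by simp, hyx.symm⟩
    -- by the last components, the two final segments have equal lengths, and both reach `x`
    have hst : t.length = s.length := by
      have a1 := congrArg (fun x : Γ.Point => x.2.2) hxt
      have a2 := congrArg (fun x : Γ.Point => x.2.2) hxs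
      simp only [pushPath_length] at a1 a2
      lia
    have : t = s := by
      have hpts : ∀ (t s : List Γ.E) (w : Γ.V), Γ.IsPath w t w' → pushPath t y = pushPath s y →
          t.length = s.length → (∃ w₂, Γ.IsPath w₂ s w') → t = s := by
        rintro t s w ht hts hl ⟨w₂, hs⟩
        rcases prefix_or_prefix_of_pushPath_eq ht hs hy hy hts with ⟨r, rfl, -⟩ | ⟨r, rfl, -⟩
        · obtain rfl : r = [] := by simpa using hl
          simp
        · obtain rfl : r = [] := by simpa using hl
          simp
      obtain ⟨w₂, -, hs⟩ := isPath_append_iff.1 (hqs ▸ hq')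
      exact hpts t s w ht (hxt.symm.trans hxs) hst ⟨w₂, hs⟩
    exact ⟨y, t, hy, hpt, this ▸ hqs, hxt, ht⟩
  -- `t` does not depend on the point, and by `key` every point over its source is reached by `t`
  obtain ⟨-, t, -, hpt, hqt, -, ht⟩ := key (w, Sum.inl 0, 0) rfl
  refine ⟨t, hpt, hqt, isNEPath_of_forall_exists_pushPath ht fun x hx => ?_⟩
  obtain ⟨y, t', hy, hpt', -, hxy, -⟩ := key x hx
  obtain rfl : t = t' := List.append_cancel_left (hpt.symm.trans hpt')
  exact ⟨y, hy, hxy⟩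

end Representation

end DirGraph

/-! ### Invariants of semigroups -/

section Semigroup

variable {S : Type*} [Semigroup S]

/-- `x` and `y` are inverses of each other in the sense of inverse semigroup theory. -/
def MutuallyInverse (x y : S) : Prop := x * y * x = x ∧ y * x * y = y

/-- Green's relation `𝒟` between idempotents of an inverse semigroup. -/
def GreenD (a b : S) : Prop := ∃ x y, MutuallyInverse x y ∧ x * y = a ∧ y * x = b

/-- The maximal subgroup at the idempotent `a` is nontrivial. -/
def HasNontrivialSubgroup (a : S) : Prop :=
  ∃ x y, MutuallyInverse x y ∧ x * y = a ∧ y * x = a ∧ x ≠ a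

/-- `a` is an idempotent that is not a left zero, and is maximal among the idempotents. -/
def IsMaximalIdempotent (a : S) : Prop :=
  a * a = a ∧ (∃ g, a * g ≠ a) ∧ ∀ g, g * g = g → a * g = a → g = a

/-- `f` is maximal among the idempotents strictly below the idempotent `a`, and not a
left zero. -/
def IsSubmaximalIdempotent (a f : S) : Prop :=
  f * f = f ∧ a * f = f ∧ (∃ g, f * g ≠ f) ∧ f ≠ a ∧
    ∀ g, g * g = g → a * g = g → f * g = f → g = f ∨ g = a

theorem GreenD.symm {a b : S} : GreenD a b → GreenD b a :=
  fun ⟨x, y, h, ha, hb⟩ => ⟨y, x, ⟨h.2, h.1⟩, hb, ha⟩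

theorem GreenD.trans {a b c : S} : GreenD a b → GreenD b c → GreenD a c := by
  rintro ⟨x, y, ⟨h1, h2⟩, rfl, rfl⟩ ⟨x', y', ⟨h3, h4⟩, hb, rfl⟩
  have h5 : x * x' * (y' * y) = x * y := by
    rw [mul_assoc, ← mul_assoc x', hb, ← mul_assoc, ← mul_assoc, h1]
  have h6 : y' * y * (x * x') = y' * x' := by
    rw [mul_assoc, ← mul_assoc y, ← hb, ← mul_assoc, ← mul_assoc, h4]
  exact ⟨x * x', y' * y, ⟨by rw [h5, ← mul_assoc, h1], by rw [h6, ← mul_assoc, h4]⟩, h5, h6⟩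

/-- In a semigroup with commuting idempotents, inverses are unique. -/
theorem MutuallyInverse.unique (hcomm : ∀ f g : S, f * f = f → g * g = g → f * g = g * f)
    {x y z : S} (hy : MutuallyInverse x y) (hz : MutuallyInverse x z) : y = z := by
  have h1 : y = z * x * y := by
    calc y = y * x * (z * x) * y := by
          rw [← mul_assoc, mul_assoc y x z, mul_assoc y, hz.1, hy.2]
      _ = z * x * (y * x) * y := by
          rw [hcomm (y * x) (z * x) (by rw [← mul_assoc, hy.2]) (by rw [← mul_assoc, hz.2])]
      _ = z * x * y := by rw [mul_assoc, hy.2]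
  have h2 : z = z * x * y := by
    calc z = z * (x * y * (x * z)) := by
          rw [← mul_assoc (x * y), hy.1, ← mul_assoc, hz.2]
      _ = z * (x * z * (x * y)) := by
          rw [hcomm (x * y) (x * z) (by rw [← mul_assoc, hy.1]) (by rw [← mul_assoc, hz.1])]
      _ = z * x * y := by rw [← mul_assoc (x * z), hz.1, mul_assoc]
  rw [h1, ← h2]

variable {S' : Type*} [Semigroup S'] (θ : S ≃* S')

theorem MutuallyInverse.map {x y : S} (h : MutuallyInverse x y) :
    MutuallyInverse (θ x) (θ y) := by
  rw [MutuallyInverse, ← map_mul, ← map_mul, ← map_mul, ← map_mul, h.1, h.2]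
  exact ⟨rfl, rfl⟩

theorem greenD_map_iff {a b : S} : GreenD (θ a) (θ b) ↔ GreenD a b := by
  constructor
  · rintro ⟨x, y, h, h1, h2⟩
    refine ⟨θ.symm x, θ.symm y, h.map θ.symm, ?_, ?_⟩ <;>
      rw [← map_mul, MulEquiv.symm_apply_eq] <;> assumption
  · rintro ⟨x, y, h, rfl, rfl⟩
    exact ⟨θ x, θ y, h.map θ, (map_mul θ _ _).symm, (map_mul θ _ _).symm⟩

theorem hasNontrivialSubgroup_map_iff {a : S} :
    HasNontrivialSubgroup (θ a) ↔ HasNontrivialSubgroup a := by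
  constructor
  · rintro ⟨x, y, h, h1, h2, h3⟩
    refine ⟨θ.symm x, θ.symm y, h.map θ.symm, ?_, ?_, ?_⟩
    · rw [← map_mul, MulEquiv.symm_apply_eq, h1]
    · rw [← map_mul, MulEquiv.symm_apply_eq, h2]
    · rwa [ne_eq, MulEquiv.symm_apply_eq]
  · rintro ⟨x, y, h, h1, h2, h3⟩
    exact ⟨θ x, θ y, h.map θ, by rw [← map_mul, h1], by rw [← map_mul, h2],
      θ.injective.ne h3⟩

theorem isMaximalIdempotent_map_iff {a : S} :
    IsMaximalIdempotent (θ a) ↔ IsMaximalIdempotent a := by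
  simp only [IsMaximalIdempotent, θ.surjective.exists, θ.surjective.forall, ← map_mul, ne_eq,
    EmbeddingLike.apply_eq_iff_eq]

theorem isSubmaximalIdempotent_map_iff {a f : S} :
    IsSubmaximalIdempotent (θ a) (θ f) ↔ IsSubmaximalIdempotent a f := by
  simp only [IsSubmaximalIdempotent, θ.surjective.exists, θ.surjective.forall, ← map_mul, ne_eq,
    EmbeddingLike.apply_eq_iff_eq]

end Semigroup

namespace DirGraph

/-! ### Idempotents of the Leavitt inverse semigroup -/

section Idempotents

open LeavittPathAlgebra

theorem IsPath.source_unique {Γ : DirGraph} {v v' w : Γ.V} {p : List Γ.E}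
    (h : Γ.IsPath v p w) (h' : Γ.IsPath v' p w) : v = v' := by
  cases p with
  | nil => exact (isPath_nil_iff.1 h).trans (isPath_nil_iff.1 h').symm
  | cons e p => exact (isPath_cons_iff.1 h).1.symm.trans (isPath_cons_iff.1 h').1

/-- A path contains an edge with exits, unless it is an NE path. -/
theorem IsPath.isNEPath_or_exists {Γ : DirGraph} {v w : Γ.V} {p : List Γ.E}
    (h : Γ.IsPath v p w) : Γ.IsNEPath v p w ∨
      ∃ p₁ e p₂, p = p₁ ++ [e] ++ p₂ ∧ Γ.IsNEPath v p₁ (Γ.src e) ∧ ¬Γ.IsNE e ∧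
        Γ.IsPath (Γ.rng e) p₂ w := by
  induction p generalizing v with
  | nil => exact Or.inl ⟨h, by simp⟩
  | cons e p ih =>
    obtain ⟨rfl, h₂⟩ := isPath_cons_iff.1 h
    by_cases he : Γ.IsNE e
    · rcases ih h₂ with hp | ⟨p₁, f, p₂, rfl, hp₁, hf, hp₂⟩
      · exact Or.inl (isPathIn_cons_iff.2 ⟨rfl, he, hp⟩)
      · exact Or.inr ⟨e :: p₁, f, p₂, rfl, isPathIn_cons_iff.2 ⟨rfl, he, hp₁⟩, hf, hp₂⟩
    · exact Or.inr ⟨[], e, p, rfl, IsPathIn.nil _, he, h₂⟩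

variable {F : Type*} [Field F] {Γ : DirGraph}

variable (F) in
/-- The element `p q*` of the Leavitt inverse semigroup. -/
noncomputable def pathMul (v : Γ.V) (p : List Γ.E) (u : Γ.V) (q : List Γ.E) :
    LeavittInverseSemigroup F Γ :=
  ⟨pe F Γ v p * ps F Γ u q, mul_mem (pe_mem v p) (ps_mem u q)⟩

variable (F) in
/-- The idempotent `p p*` of the Leavitt inverse semigroup. -/
noncomputable def pathProj (v : Γ.V) (p : List Γ.E) : LeavittInverseSemigroup F Γ :=
  pathMul F v p v p

variable (F) in
/-- A vertex, as an element of the Leavitt inverse semigroup. -/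
noncomputable def vtx (v : Γ.V) : LeavittInverseSemigroup F Γ := ⟨vx F Γ v, gen_mem _⟩

theorem pathProj_nil (v : Γ.V) : pathProj F v [] = vtx F v := Subtype.ext (vx_mul_self v)

theorem pathProj_ne_zero {v w : Γ.V} {p : List Γ.E} (hp : Γ.IsPath v p w) :
    (pathProj F v p).1 ≠ 0 := pe_mul_ps_ne_zero hp hp

theorem vtx_ne_zero (v : Γ.V) : (vtx F v).1 ≠ 0 :=
  pathProj_nil (F := F) v ▸ pathProj_ne_zero (IsPath.nil v)

theorem exists_mul_ne_iff {f : LeavittInverseSemigroup F Γ} : (∃ g, f * g ≠ f) ↔ f.1 ≠ 0 := by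
  constructor
  · rintro ⟨g, hg⟩ h0
    refine hg (Subtype.ext ?_)
    change f.1 * g.1 = f.1
    rw [h0, zero_mul]
  · intro h0
    refine ⟨⟨0, zero_mem⟩, fun h => h0 ?_⟩
    have h1 : f.1 * 0 = f.1 := congrArg Subtype.val h
    rw [← h1, mul_zero]

theorem pathMul_mul_pathMul {v u x w : Γ.V} {p q r : List Γ.E} (hp : Γ.IsPath v p w)
    (hq : Γ.IsPath u q w) : pathMul F v p u q * pathMul F u q x r = pathMul F v p x r := by
  refine Subtype.ext ?_
  change pe F Γ v p * ps F Γ u q * (pe F Γ u q * ps F Γ x r) = pe F Γ v p * ps F Γ x r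
  rw [mul_assoc, ← mul_assoc (ps F Γ u q), ps_mul_pe hq, ← mul_assoc, pe_mul_vx hp]

theorem pathProj_mul_self {v w : Γ.V} {p : List Γ.E} (hp : Γ.IsPath v p w) :
    pathProj F v p * pathProj F v p = pathProj F v p := pathMul_mul_pathMul hp hp

theorem mutuallyInverse_pathMul {v u w : Γ.V} {p q : List Γ.E} (hp : Γ.IsPath v p w)
    (hq : Γ.IsPath u q w) : MutuallyInverse (pathMul F v p u q) (pathMul F u q v p) := by
  constructor
  · rw [pathMul_mul_pathMul hp hq, pathMul_mul_pathMul hp hp]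
  · rw [pathMul_mul_pathMul hq hp, pathMul_mul_pathMul hq hq]

theorem pathProj_append_mul {v w x : Γ.V} {p t : List Γ.E} (hp : Γ.IsPath v p w)
    (ht : Γ.IsPath w t x) :
    pathProj F v (p ++ t) * pathProj F v p = pathProj F v (p ++ t) := by
  refine Subtype.ext ?_
  change pe F Γ v (p ++ t) * ps F Γ v (p ++ t) * (pe F Γ v p * ps F Γ v p) =
    pe F Γ v (p ++ t) * ps F Γ v (p ++ t)
  rw [ps_append hp ht]
  simp only [mul_assoc]
  rw [← mul_assoc (ps F Γ v p), ps_mul_pe hp, vx_mul_ps hp]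

theorem pathProj_mul_append {v w x : Γ.V} {p t : List Γ.E} (hp : Γ.IsPath v p w)
    (ht : Γ.IsPath w t x) :
    pathProj F v p * pathProj F v (p ++ t) = pathProj F v (p ++ t) := by
  refine Subtype.ext ?_
  change pe F Γ v p * ps F Γ v p * (pe F Γ v (p ++ t) * ps F Γ v (p ++ t)) =
    pe F Γ v (p ++ t) * ps F Γ v (p ++ t)
  rw [pe_append hp ht]
  simp only [← mul_assoc]
  rw [mul_assoc (pe F Γ v p), ps_mul_pe hp, pe_mul_vx hp]

theorem pathProj_of_isNEPath {v w : Γ.V} {p : List Γ.E} (hp : Γ.IsNEPath v p w) :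
    pathProj F v p = vtx F v := Subtype.ext (pe_mul_ps_of_isNEPath hp)

theorem isNEPath_of_pathProj_eq_vtx {v v' w : Γ.V} {p : List Γ.E} (hp : Γ.IsPath v' p w)
    (h : pathProj F v' p = vtx F v) : Γ.IsNEPath v p w := by
  rw [← pathProj_nil] at h
  rcases exists_isNEPath_of_pe_mul_ps_eq hp hp (.nil v) (.nil v) (congrArg Subtype.val h) with
    ⟨t, h1, -, ht⟩ | ⟨t, rfl, -, ht⟩
  · obtain ⟨rfl, rfl⟩ := List.append_eq_nil_iff.1 h1.symm
    exact isPathIn_nil_iff.2 (isPathIn_nil_iff.1 ht).symm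
  · exact ht

/-- The idempotents of the Leavitt inverse semigroup are `0` and the elements `p p*`. -/
theorem eq_zero_or_eq_pathProj {f : LeavittInverseSemigroup F Γ} (hf : f * f = f) :
    f.1 = 0 ∨ ∃ v p w, Γ.IsPath v p w ∧ f = pathProj F v p := by
  rcases eq_zero_or_exists_of_mem f.2 with h | ⟨v, p, u, q, w, hp, hq, hfe⟩
  · exact Or.inl h
  have hf' : f.1 * f.1 = f.1 := congrArg Subtype.val hf
  rw [hfe, mul_assoc, ← mul_assoc (ps F Γ u q)] at hf'
  right
  rcases prefix_or_ps_mul_pe_eq_zero (F := F) hq hp with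
    ⟨rfl, ⟨t, rfl, ht⟩ | ⟨t, rfl, ht⟩⟩ | h0
  · have h1 : ps F Γ u q * pe F Γ u (q ++ t) = pe F Γ w t := by
      rw [pe_append hq ht, ← mul_assoc, ps_mul_pe hq, vx_mul_pe ht]
    rw [h1, ← mul_assoc, ← pe_append hp ht] at hf'
    have ht0 : t = [] := by
      rcases exists_isNEPath_of_pe_mul_ps_eq (hp.append ht) hq hp hq hf' with
        ⟨s, h2, -, -⟩ | ⟨s, h2, h3, -⟩
      · rw [List.append_assoc (_ ++ _), List.self_eq_append_right] at h2
        exact (List.append_eq_nil_iff.1 h2).1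
      · obtain rfl : s = [] := by simpa using h3
        simpa using h2
    subst ht0
    exact ⟨u, q, w, hq, Subtype.ext (by rw [hfe, List.append_nil]; rfl)⟩
  · have h1 : ps F Γ u (p ++ t) * pe F Γ u p = ps F Γ w t := by
      rw [ps_append hp ht, mul_assoc, ps_mul_pe hp, ps_mul_vx ht]
    rw [h1, ← ps_append hq ht] at hf'
    have ht0 : t = [] := by
      rcases exists_isNEPath_of_pe_mul_ps_eq hp (hq.append ht) hp hq hf' with
        ⟨s, -, h2, -⟩ | ⟨s, h3, h2, -⟩
      · rw [List.append_assoc (_ ++ _), List.self_eq_append_right] at h2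
        exact (List.append_eq_nil_iff.1 h2).1
      · obtain rfl : s = [] := by simpa using h3
        simpa using h2
    subst ht0
    exact ⟨u, p, w, hp, Subtype.ext (by rw [hfe, List.append_nil]; rfl)⟩
  · rw [h0, zero_mul, mul_zero] at hf'
    exact absurd hf'.symm (pe_mul_ps_ne_zero hp hq)

theorem prefix_or_pathProj_mul_eq_zero {v w v' w' : Γ.V} {p q : List Γ.E} (hp : Γ.IsPath v p w)
    (hq : Γ.IsPath v' q w') :
    v = v' ∧ ((∃ t, q = p ++ t ∧ Γ.IsPath w t w') ∨ ∃ t, p = q ++ t ∧ Γ.IsPath w' t w) ∨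
      (pathProj F v p * pathProj F v' q).1 = 0 := by
  refine (prefix_or_ps_mul_pe_eq_zero (F := F) hp hq).imp_right fun h => ?_
  change pe F Γ v p * ps F Γ v p * (pe F Γ v' q * ps F Γ v' q) = 0
  rw [mul_assoc, ← mul_assoc (ps F Γ v p), h, zero_mul, mul_zero]

theorem idempotents_commute (f g : LeavittInverseSemigroup F Γ) (hf : f * f = f)
    (hg : g * g = g) : f * g = g * f := by
  rcases eq_zero_or_eq_pathProj hf with h | ⟨v, p, w, hp, rfl⟩
  · refine Subtype.ext ?_
    change f.1 * g.1 = g.1 * f.1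
    rw [h, zero_mul, mul_zero]
  rcases eq_zero_or_eq_pathProj hg with h | ⟨v', q, w', hq, rfl⟩
  · refine Subtype.ext ?_
    change _ * g.1 = g.1 * _
    rw [h, zero_mul, mul_zero]
  rcases prefix_or_pathProj_mul_eq_zero (F := F) hp hq with
    ⟨rfl, ⟨t, rfl, ht⟩ | ⟨t, rfl, ht⟩⟩ | h
  · rw [pathProj_mul_append hp ht, pathProj_append_mul hp ht]
  · rw [pathProj_mul_append hq ht, pathProj_append_mul hq ht]
  · rcases prefix_or_pathProj_mul_eq_zero (F := F) hq hp with
      ⟨rfl, ⟨t, rfl, ht⟩ | ⟨t, rfl, ht⟩⟩ | h'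
    · rw [pathProj_mul_append hq ht, pathProj_append_mul hq ht]
    · rw [pathProj_mul_append hp ht, pathProj_append_mul hp ht]
    · exact Subtype.ext (h.trans h'.symm)

theorem exists_of_mutuallyInverse {x y : LeavittInverseSemigroup F Γ}
    (h : MutuallyInverse x y) (hx : (x * y).1 ≠ 0) :
    ∃ v p u q w, Γ.IsPath v p w ∧ Γ.IsPath u q w ∧ x = pathMul F v p u q ∧
      x * y = pathProj F v p ∧ y * x = pathProj F u q := by
  rcases eq_zero_or_exists_of_mem x.2 with h0 | ⟨v, p, u, q, w, hp, hq, hxe⟩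
  · refine absurd ?_ hx
    change x.1 * y.1 = 0
    rw [h0, zero_mul]
  obtain rfl : x = pathMul F v p u q := Subtype.ext hxe
  obtain rfl := h.unique idempotents_commute (mutuallyInverse_pathMul hp hq)
  exact ⟨v, p, u, q, w, hp, hq, rfl, pathMul_mul_pathMul hp hq, pathMul_mul_pathMul hq hp⟩

/-! ### Reading off the contracted graph from the Leavitt inverse semigroup -/

theorem vtx_mul_pathProj {v w : Γ.V} {p : List Γ.E} (hp : Γ.IsPath v p w) :
    vtx F v * pathProj F v p = pathProj F v p := by
  rw [← pathProj_nil]; exact pathProj_mul_append (.nil v) hp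

theorem pathProj_mul_vtx {v w : Γ.V} {p : List Γ.E} (hp : Γ.IsPath v p w) :
    pathProj F v p * vtx F v = pathProj F v p := by
  rw [← pathProj_nil]; exact pathProj_append_mul (.nil v) hp

theorem vtx_mul_self (v : Γ.V) : vtx F v * vtx F v = vtx F v := Subtype.ext (vx_mul_self v)

theorem eq_of_vtx_mul_pathProj_ne_zero {v v' w : Γ.V} {p : List Γ.E} (hp : Γ.IsPath v' p w)
    (h : (vtx F v * pathProj F v' p).1 ≠ 0) : v = v' := by
  rw [← pathProj_nil] at h
  rcases prefix_or_pathProj_mul_eq_zero (F := F) (.nil v) hp with h' | h'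
  · exact h'.1
  · exact absurd h' h

theorem vtx_injective : Function.Injective (vtx F : Γ.V → LeavittInverseSemigroup F Γ) := by
  intro v w h
  refine eq_of_vtx_mul_pathProj_ne_zero (F := F) (.nil w) ?_
  rw [pathProj_nil, ← h, vtx_mul_self]
  exact vtx_ne_zero v

theorem isMaximalIdempotent_iff {f : LeavittInverseSemigroup F Γ} :
    IsMaximalIdempotent f ↔ ∃ v, vtx F v = f := by
  constructor
  · rintro ⟨hf, h0, hmax⟩
    rw [exists_mul_ne_iff] at h0
    rcases eq_zero_or_eq_pathProj hf with h | ⟨v, p, w, hp, rfl⟩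
    · exact absurd h h0
    · exact ⟨v, hmax _ (vtx_mul_self v) (pathProj_mul_vtx hp)⟩
  · rintro ⟨v, rfl⟩
    refine ⟨vtx_mul_self v, exists_mul_ne_iff.2 (vtx_ne_zero v), fun g hg hvg => ?_⟩
    rcases eq_zero_or_eq_pathProj hg with h | ⟨v', p, w, hp, rfl⟩
    · refine absurd ?_ (vtx_ne_zero (F := F) v)
      rw [← hvg]
      change _ * g.1 = 0
      rw [h, mul_zero]
    · obtain rfl := eq_of_vtx_mul_pathProj_ne_zero (F := F) hp (hvg.symm ▸ vtx_ne_zero v)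
      rw [← hvg, vtx_mul_pathProj hp]

theorem greenD_pathProj {v w : Γ.V} {p : List Γ.E} (hp : Γ.IsPath v p w) :
    GreenD (pathProj F v p) (vtx F w) := by
  refine ⟨pathMul F v p w [], pathMul F w [] v p, mutuallyInverse_pathMul hp (.nil w), ?_, ?_⟩
  · exact pathMul_mul_pathMul hp (.nil w)
  · rw [pathMul_mul_pathMul (.nil w) hp]; exact pathProj_nil w

theorem greenD_vtx_iff {v w : Γ.V} : GreenD (vtx F v) (vtx F w) ↔ Γ.cls v = Γ.cls w := by
  rw [cls_eq_iff]
  constructor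
  · rintro ⟨x, y, h, h1, h2⟩
    obtain ⟨v', p, u, q, z, hp, hq, -, h3, h4⟩ :=
      exists_of_mutuallyInverse h (h1 ▸ vtx_ne_zero v)
    exact ⟨p, q, z, isNEPath_of_pathProj_eq_vtx hp (h3.symm.trans h1),
      isNEPath_of_pathProj_eq_vtx hq (h4.symm.trans h2)⟩
  · rintro ⟨p, q, z, hp, hq⟩
    have h1 := greenD_pathProj (F := F) hp.1
    have h2 := greenD_pathProj (F := F) hq.1
    rw [pathProj_of_isNEPath hp] at h1
    rw [pathProj_of_isNEPath hq] at h2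
    exact h1.trans h2.symm

/-- The maximal subgroup at a vertex is nontrivial exactly if the class of the vertex contains a
nontrivial closed NE path. -/
theorem hasNontrivialSubgroup_vtx_iff {v : Γ.V} : HasNontrivialSubgroup (vtx F v) ↔
    ∃ w t, Γ.cls v = Γ.cls w ∧ t ≠ [] ∧ Γ.IsNEPath w t w := by
  constructor
  · rintro ⟨x, y, h, h1, h2, hne⟩
    obtain ⟨v', p, u', q, z, hp, hq, rfl, h3, h4⟩ :=
      exists_of_mutuallyInverse h (h1 ▸ vtx_ne_zero v)
    have hp' := isNEPath_of_pathProj_eq_vtx hp (h3.symm.trans h1)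
    have hq' := isNEPath_of_pathProj_eq_vtx hq (h4.symm.trans h2)
    obtain rfl := hp.source_unique hp'.1
    obtain rfl := hq.source_unique hq'.1
    have hcls := IsPathIn.cls_eq subset_rfl hp'
    rcases IsPathIn.prefix_or_prefix subset_rfl hp' hq' with ⟨t, rfl, ht⟩ | ⟨t, rfl, ht⟩
    all_goals
      refine ⟨z, t, hcls, fun h0 => hne ?_, ht⟩
      subst h0
      rw [List.append_nil]
      exact pathProj_of_isNEPath (by assumption)
  · rintro ⟨w, t, hvw, ht, hwt⟩
    obtain ⟨q, r, z, hq, hr⟩ := cls_eq_iff.1 hvw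
    obtain ⟨s, hs, hzs⟩ := hr.exists_closed (A := Γ.neEdges) ⟨t, ht, hwt⟩
    have hqs := hq.append hzs
    refine ⟨pathMul F v (q ++ s) v q, pathMul F v q v (q ++ s),
      mutuallyInverse_pathMul hqs.1 hq.1, ?_, ?_, fun h => hs ?_⟩
    · rw [pathMul_mul_pathMul hqs.1 hq.1]; exact pathProj_of_isNEPath hqs
    · rw [pathMul_mul_pathMul hq.1 hqs.1]; exact pathProj_of_isNEPath hq
    · rw [← pathProj_of_isNEPath hq] at h
      rcases exists_isNEPath_of_pe_mul_ps_eq hqs.1 hq.1 hq.1 hq.1 (congrArg Subtype.val h) with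
        ⟨m, h1, -, -⟩ | ⟨m, h1, h2, -⟩
      · have := congrArg List.length h1
        simp at this
        exact List.length_eq_zero_iff.1 (by lia)
      · obtain rfl : m = [] := by simpa using h2
        simpa using h1

/-- The idempotents directly below a vertex `v` are those of the paths that leave the NE
edges with their last edge. -/
theorem isSubmaximalIdempotent_vtx_iff {v : Γ.V} {f : LeavittInverseSemigroup F Γ} :
    IsSubmaximalIdempotent (vtx F v) f ↔
      ∃ p e, Γ.IsNEPath v p (Γ.src e) ∧ ¬Γ.IsNE e ∧ pathProj F v (p ++ [e]) = f := by
  have hlast : ∀ {p e}, Γ.IsNEPath v p (Γ.src e) → ¬Γ.IsNE e →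
      Γ.IsPath v (p ++ [e]) (Γ.rng e) ∧ pathProj F v (p ++ [e]) ≠ vtx F v := by
    intro p e hp he
    have hpe := hp.1.append (IsPath.cons e (.nil _))
    exact ⟨hpe, fun h => he ((isNEPath_of_pathProj_eq_vtx hpe h).2 e (by simp))⟩
  constructor
  · rintro ⟨hff, hvf, h0, hne, hmax⟩
    rw [exists_mul_ne_iff] at h0
    rcases eq_zero_or_eq_pathProj hff with h | ⟨v', p, w, hp, rfl⟩
    · exact absurd h h0
    obtain rfl := eq_of_vtx_mul_pathProj_ne_zero (F := F) hp (hvf.symm ▸ h0)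
    rcases hp.isNEPath_or_exists with hp' | ⟨p₁, e, p₂, rfl, hp₁, he, hp₂⟩
    · exact absurd (pathProj_of_isNEPath hp') hne
    · obtain ⟨hpe, hpv⟩ := hlast hp₁ he
      refine ⟨p₁, e, hp₁, he, ?_⟩
      exact (hmax _ (pathProj_mul_self hpe) (vtx_mul_pathProj hpe)
        (pathProj_append_mul hpe hp₂)).resolve_right hpv
  · rintro ⟨p, e, hp, he, rfl⟩
    obtain ⟨hpe, hpv⟩ := hlast hp he
    have h0 := pathProj_ne_zero (F := F) hpe
    refine ⟨pathProj_mul_self hpe, vtx_mul_pathProj hpe, exists_mul_ne_iff.2 h0, hpv,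
      fun g hg hvg hfg => ?_⟩
    have hg0 : g.1 ≠ 0 := by
      intro h
      rw [← hfg] at h0
      refine h0 ?_
      change _ * g.1 = 0
      rw [h, mul_zero]
    rcases eq_zero_or_eq_pathProj hg with h | ⟨v', q, w, hq, rfl⟩
    · exact absurd h hg0
    obtain rfl := eq_of_vtx_mul_pathProj_ne_zero (F := F) hq (hvg.symm ▸ hg0)
    rcases prefix_or_pathProj_mul_eq_zero (F := F) hpe hq with
      ⟨-, ⟨t, rfl, ht⟩ | ⟨t, hqt, ht⟩⟩ | h
    · left; rw [← hfg, pathProj_mul_append hpe ht]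
    · rcases List.eq_nil_or_concat' t with rfl | ⟨s, e', rfl⟩
      · left; rw [hqt, List.append_nil]
      · right
        rw [← List.append_assoc] at hqt
        obtain ⟨rfl, -⟩ := List.append_inj' hqt rfl
        exact pathProj_of_isNEPath ⟨hq, fun a ha => hp.2 a (by simp [ha])⟩
    · rw [hfg] at h; exact absurd h h0

/-- If the last edge of a path, and no other edge, has exits, then it is determined by the
idempotent of the path: appending a nontrivial NE path gives a path whose last edge has
no exits. -/
theorem last_edge_eq_of_pathProj_eq {v : Γ.V} {p q : List Γ.E} {e f : Γ.E}
    (hp : Γ.IsNEPath v p (Γ.src e)) (he : ¬Γ.IsNE e) (hq : Γ.IsNEPath v q (Γ.src f))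
    (hf : ¬Γ.IsNE f) (h : pathProj F v (p ++ [e]) = pathProj F v (q ++ [f])) : e = f := by
  have hpe := hp.1.append (IsPath.cons e (.nil _))
  have hqf := hq.1.append (IsPath.cons f (.nil _))
  rcases exists_isNEPath_of_pe_mul_ps_eq hpe hpe hqf hqf (congrArg Subtype.val h) with
    ⟨t, h1, -, ht⟩ | ⟨t, h1, -, ht⟩
  all_goals
    rcases List.eq_nil_or_concat' t with rfl | ⟨s, a, rfl⟩
    · rw [List.append_nil] at h1
      have h2 := (List.append_inj' h1 rfl).2
      simp only [List.cons.injEq, and_true] at h2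
      first | exact h2 | exact h2.symm
    · rw [← List.append_assoc] at h1
      have h2 := (List.append_inj' h1 rfl).2
      have h3 := ht.2 a (by simp)
      simp only [List.cons.injEq, and_true] at h2
      subst h2
      contradiction

/-- The edges outside the trees with source equivalent to `v` and range equivalent to `w`. -/
abbrev EdgeFiber (T : Γ.NESpanningTrees) (v w : Γ.V) : Type _ :=
  {e : {e : Γ.E // e ∉ T.treeEdges} //
    (Γ.cls (Γ.src e), Γ.cls (Γ.rng e)) = (Γ.cls v, Γ.cls w)}

theorem EdgeFiber.cls_src {T : Γ.NESpanningTrees} {v w : Γ.V} (e : EdgeFiber T v w) :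
    Γ.cls (Γ.src e.1) = Γ.cls v := (Prod.ext_iff.1 e.2).1

theorem EdgeFiber.cls_rng {T : Γ.NESpanningTrees} {v w : Γ.V} (e : EdgeFiber T v w) :
    Γ.cls (Γ.rng e.1) = Γ.cls w := (Prod.ext_iff.1 e.2).2

variable (F) in
/-- The edges with exits correspond to the idempotents directly below `v`. -/
theorem nonempty_equiv_submaximal (T : Γ.NESpanningTrees) (v w : Γ.V) :
    Nonempty ({e : EdgeFiber T v w // ¬Γ.IsNE e.1.1} ≃
      {f : LeavittInverseSemigroup F Γ //
        IsSubmaximalIdempotent (vtx F v) f ∧ GreenD f (vtx F w)}) := by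
  have hex : ∀ e : {e : EdgeFiber T v w // ¬Γ.IsNE e.1.1},
      ∃ p, Γ.IsNEPath v p (Γ.src e.1.1) := fun e =>
    exists_isNEPath_of_cls_eq (fun f hf hf' => e.2 (IsNE.eq_of_src_eq hf' hf.symm ▸ hf'))
      e.1.cls_src.symm
  choose p hp using hex
  have hpath := fun e => (hp e).1.append (IsPath.cons e.1.1.1 (.nil _))
  let φ : {e : EdgeFiber T v w // ¬Γ.IsNE e.1.1} → {f : LeavittInverseSemigroup F Γ //
      IsSubmaximalIdempotent (vtx F v) f ∧ GreenD f (vtx F w)} := fun e =>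
    ⟨pathProj F v (p e ++ [e.1.1.1]),
      isSubmaximalIdempotent_vtx_iff.2 ⟨_, _, hp e, e.2, rfl⟩,
      (greenD_pathProj (hpath e)).trans (greenD_vtx_iff.2 e.1.cls_rng)⟩
  refine ⟨Equiv.ofBijective φ ⟨fun e f h => ?_, fun ⟨f, hf, hfw⟩ => ?_⟩⟩
  · exact Subtype.ext (Subtype.ext (Subtype.ext
      (last_edge_eq_of_pathProj_eq (hp e) e.2 (hp f) f.2 (congrArg Subtype.val h))))
  · obtain ⟨q, e, hq, he, rfl⟩ := isSubmaximalIdempotent_vtx_iff.1 hf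
    have hqe := hq.1.append (IsPath.cons e (.nil _))
    let e' : {e : EdgeFiber T v w // ¬Γ.IsNE e.1.1} :=
      ⟨⟨⟨e, fun h => he (NESpanningTrees.treeEdges_subset h)⟩, Prod.ext
        (IsPathIn.cls_eq subset_rfl hq).symm
        (greenD_vtx_iff.1 ((greenD_pathProj (F := F) hqe).symm.trans hfw))⟩, he⟩
    refine ⟨e', Subtype.ext ?_⟩
    change pathProj F v (p e' ++ [e]) = pathProj F v (q ++ [e])
    congr 2
    -- two NE paths from `v` to the source of `e` are comparable, and no nontrivial NE path starts
    -- at that source because `e` has exits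
    have hnil : ∀ {t : List Γ.E}, Γ.IsNEPath (Γ.src e) t (Γ.src e) → t = [] := by
      intro t ht
      cases t with
      | nil => rfl
      | cons a t =>
        obtain ⟨ha, hNE, -⟩ := isPathIn_cons_iff.1 ht
        exact absurd (IsNE.eq_of_src_eq hNE ha.symm ▸ hNE : Γ.IsNE e) he
    rcases IsPathIn.prefix_or_prefix subset_rfl (hp e') hq with ⟨t, h, ht⟩ | ⟨t, h, ht⟩
    · rw [h, hnil ht, List.append_nil]
    · rw [h, hnil ht, List.append_nil]

variable (F) in
/-- At most one NE edge with source equivalent to `v` lies outside the trees; there is one exactly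
if the maximal subgroup at `v` is nontrivial. -/
theorem nonempty_equiv_plift (T : Γ.NESpanningTrees) (v w : Γ.V) :
    Nonempty ({e : EdgeFiber T v w // Γ.IsNE e.1.1} ≃
      PLift (GreenD (vtx F v) (vtx F w) ∧ HasNontrivialSubgroup (vtx F v))) := by
  have hsub : Subsingleton {e : EdgeFiber T v w // Γ.IsNE e.1.1} := ⟨fun e f => by
    refine Subtype.ext (Subtype.ext (Subtype.ext (IsNE.eq_of_src_eq f.2 ?_)))
    exact NESpanningTrees.src_eq_src e.1.1.2 f.1.1.2 (e.1.cls_src.trans f.1.cls_src.symm)⟩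
  have hto : ∀ e : {e : EdgeFiber T v w // Γ.IsNE e.1.1},
      GreenD (vtx F v) (vtx F w) ∧ HasNontrivialSubgroup (vtx F v) := by
    rintro ⟨⟨⟨e, heT⟩, h⟩, he⟩
    obtain ⟨h1, h2⟩ := Prod.ext_iff.1 h
    have hrs := IsNE.cls_rng he
    refine ⟨greenD_vtx_iff.2 (h1.symm.trans (hrs.symm.trans h2)), ?_⟩
    -- the tree leads from the range of `e` back to its source
    obtain ⟨p, q, u, hp, hq⟩ := T.confluent hrs
    obtain rfl : Γ.src e = u := by
      cases q with
      | nil => exact isPathIn_nil_iff.1 hq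
      | cons a q =>
        obtain ⟨ha, haT, -⟩ := isPathIn_cons_iff.1 hq
        exact absurd ((show a = e from IsNE.eq_of_src_eq he ha) ▸ haT) heT
    exact hasNontrivialSubgroup_vtx_iff.2 ⟨Γ.src e, e :: p, h1.symm, by simp,
      isPathIn_cons_iff.2 ⟨rfl, he, hp.mono NESpanningTrees.treeEdges_subset⟩⟩
  have hfrom : (GreenD (vtx F v) (vtx F w) ∧ HasNontrivialSubgroup (vtx F v)) →
      Nonempty {e : EdgeFiber T v w // Γ.IsNE e.1.1} := by
    rintro ⟨hvw, h⟩
    rw [greenD_vtx_iff] at hvw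
    obtain ⟨u, t, hvu, ht, hut⟩ := hasNontrivialSubgroup_vtx_iff.1 h
    -- some edge of the closed path lies outside the tree
    obtain ⟨e, het, heT⟩ : ∃ e ∈ t, e ∉ T.treeEdges := by
      by_contra! hall
      exact ht (T.acyclic ⟨hut.1, hall⟩)
    have he := hut.2 e het
    obtain ⟨t₁, t₂, rfl⟩ := List.append_of_mem het
    obtain ⟨x, h1, h2⟩ := isPathIn_append_iff.1 hut
    obtain ⟨rfl, -, -⟩ := isPathIn_cons_iff.1 h2
    have hs : Γ.cls (Γ.src e) = Γ.cls v := (hvu.trans (IsPathIn.cls_eq subset_rfl h1)).symm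
    exact ⟨⟨⟨⟨e, heT⟩, Prod.ext hs ((IsNE.cls_rng he).trans (hs.trans hvw))⟩, he⟩⟩
  exact ⟨equivOfSubsingletonOfSubsingleton (fun e => ⟨hto e⟩) fun h => (hfrom h.down).some⟩

end Idempotents

/-! ### Isomorphic semigroups have isomorphic contractions -/

section Invariance

variable {F : Type*} [Field F] {Γ Δ : DirGraph}

theorem exists_equiv_vtx (θ : LeavittInverseSemigroup F Γ ≃* LeavittInverseSemigroup F Δ) :
    ∃ ψ : Γ.V ≃ Δ.V, ∀ v, vtx F (ψ v) = θ (vtx F v) := by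
  have h : ∀ v : Γ.V, ∃ u : Δ.V, vtx F u = θ (vtx F v) := fun v =>
    isMaximalIdempotent_iff.1
      ((isMaximalIdempotent_map_iff θ).2 (isMaximalIdempotent_iff.2 ⟨v, rfl⟩))
  choose ψ hψ using h
  refine ⟨Equiv.ofBijective ψ ⟨fun v w hvw => ?_, fun u => ?_⟩, hψ⟩
  · exact vtx_injective (θ.injective ((hψ v).symm.trans ((congrArg _ hvw).trans (hψ w))))
  · obtain ⟨f, hf⟩ := θ.surjective (vtx F u)
    obtain ⟨v, rfl⟩ := isMaximalIdempotent_iff.1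
      ((isMaximalIdempotent_map_iff θ).1 (isMaximalIdempotent_iff.2 ⟨u, hf.symm⟩))
    exact ⟨v, vtx_injective ((hψ v).trans hf)⟩

theorem nonempty_equiv_edgeFiber
    (θ : LeavittInverseSemigroup F Γ ≃* LeavittInverseSemigroup F Δ) (T : Γ.NESpanningTrees)
    (T' : Δ.NESpanningTrees) (ψ : Γ.V ≃ Δ.V) (hψ : ∀ v, vtx F (ψ v) = θ (vtx F v))
    (v w : Γ.V) : Nonempty (EdgeFiber T v w ≃ EdgeFiber T' (ψ v) (ψ w)) := by
  classical
  obtain ⟨a⟩ := nonempty_equiv_submaximal F T v w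
  obtain ⟨b⟩ := nonempty_equiv_plift F T v w
  obtain ⟨a'⟩ := nonempty_equiv_submaximal F T' (ψ v) (ψ w)
  obtain ⟨b'⟩ := nonempty_equiv_plift F T' (ψ v) (ψ w)
  have c : {f : LeavittInverseSemigroup F Γ //
        IsSubmaximalIdempotent (vtx F v) f ∧ GreenD f (vtx F w)} ≃
      {f : LeavittInverseSemigroup F Δ //
        IsSubmaximalIdempotent (vtx F (ψ v)) f ∧ GreenD f (vtx F (ψ w))} :=
    θ.toEquiv.subtypeEquiv fun f => by
      rw [hψ, hψ]
      exact (and_congr (isSubmaximalIdempotent_map_iff θ) (greenD_map_iff θ)).symm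
  have d : PLift (GreenD (vtx F v) (vtx F w) ∧ HasNontrivialSubgroup (vtx F v)) ≃
      PLift (GreenD (vtx F (ψ v)) (vtx F (ψ w)) ∧ HasNontrivialSubgroup (vtx F (ψ v))) := by
    rw [hψ, hψ, greenD_map_iff, hasNontrivialSubgroup_map_iff]
  exact ⟨(Equiv.sumCompl fun e : EdgeFiber T v w => Γ.IsNE e.1.1).symm.trans
    ((Equiv.sumCongr ((b.trans d).trans b'.symm) ((a.trans c).trans a'.symm)).trans
      (Equiv.sumCompl fun e : EdgeFiber T' (ψ v) (ψ w) => Δ.IsNE e.1.1))⟩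

theorem nonempty_contractionEquiv
    (θ : LeavittInverseSemigroup F Γ ≃* LeavittInverseSemigroup F Δ) (T : Γ.NESpanningTrees)
    (T' : Δ.NESpanningTrees) : Nonempty (ContractionEquiv T T') := by
  obtain ⟨ψ, hψ⟩ := exists_equiv_vtx θ
  have hcls : ∀ v w, Δ.cls (ψ v) = Δ.cls (ψ w) ↔ Γ.cls v = Γ.cls w := fun v w => by
    rw [← greenD_vtx_iff (F := F), hψ, hψ, greenD_map_iff, greenD_vtx_iff]
  let κ : Γ.NEClass ≃ Δ.NEClass := Quotient.congr ψ fun v w =>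
    cls_eq_iff.symm.trans ((hcls v w).symm.trans cls_eq_iff)
  let ends : {e : Γ.E // e ∉ T.treeEdges} → Γ.NEClass × Γ.NEClass := fun e =>
    (Γ.cls (Γ.src e), Γ.cls (Γ.rng e))
  let ends' : {e : Δ.E // e ∉ T'.treeEdges} → Δ.NEClass × Δ.NEClass := fun e =>
    (Δ.cls (Δ.src e), Δ.cls (Δ.rng e))
  have hfiber : ∀ cd : Γ.NEClass × Γ.NEClass,
      Nonempty ({e // ends e = cd} ≃ {e // ends' e = κ.prodCongr κ cd}) := by
    rintro ⟨c, d⟩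
    induction c using Quotient.inductionOn with | h v
    induction d using Quotient.inductionOn with | h w
    exact nonempty_equiv_edgeFiber θ T T' ψ hψ v w
  let onE : {e : Γ.E // e ∉ T.treeEdges} ≃ {e : Δ.E // e ∉ T'.treeEdges} :=
    ((Equiv.sigmaFiberEquiv ends).symm.trans
      (Equiv.sigmaCongr (κ.prodCongr κ) fun cd => (hfiber cd).some)).trans
        (Equiv.sigmaFiberEquiv ends')
  have hE : ∀ e, ends' (onE e) = κ.prodCongr κ (ends e) := fun e =>
    ((hfiber (ends e)).some ⟨e, rfl⟩).2
  exact ⟨⟨ψ, onE, hcls, fun e => (Prod.ext_iff.1 (hE e)).1, fun e => (Prod.ext_iff.1 (hE e)).2⟩⟩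

end Invariance

end DirGraph

theorem mainTheorem1 (F : Type*) [Field F] (Γ Δ : DirGraph) :
    Nonempty (DirGraph.LeavittInverseSemigroup F Γ ≃* DirGraph.LeavittInverseSemigroup F Δ) ↔
      ∃ (ψ : Γ.V ≃ Δ.V) (T : Γ.NESpanningTrees) (T' : Δ.NESpanningTrees)
        (φ : DirGraph.Iso (Γ.contract T) (Δ.contract T')),
        ∀ v : Γ.V, φ.onV (Γ.contractV T v) = Δ.contractV T' (ψ v) := by
  constructor
  · rintro ⟨θ⟩
    obtain ⟨T⟩ := DirGraph.exists_neSpanningTrees Γ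
    obtain ⟨T'⟩ := DirGraph.exists_neSpanningTrees Δ
    obtain ⟨ψ, φ, h⟩ :=
      DirGraph.ContractionEquiv.nonempty_iff.1 (DirGraph.nonempty_contractionEquiv θ T T')
    exact ⟨ψ, T, T', φ, h⟩
  · rintro ⟨ψ, T, T', φ, h⟩
    obtain ⟨D⟩ := DirGraph.ContractionEquiv.nonempty_iff.2 ⟨ψ, φ, h⟩
    exact ⟨D.mulEquiv F⟩
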